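/- Let $n\ge 1$, $d=(d_1,\dots,d_n)$ with all $d_i\ge 1$, $\mathbf D:=\max_i d_i$ and $\Delta:=\mathrm{diag}(d_1,\dots,d_n)$. Let $\mathcal H_d[n]$ be the space of systems $f=(f_1,\dots,f_n)$ of complex homogeneous polynomials in $X_0,\dots,X_n$ with $\deg f_i=d_i$. Points of $\mathbb P^n=\mathbb P(\mathbb C^{n+1})$ are represented by vectors of Euclidean norm $1$, and $\mathrm{dist}_{\mathbb P}(z,w)=\arccos|\langle z,w\rangle|$. For $f\in\mathcal H_d[n]$ and $z\in\mathbb P^n$ put $$\|f\|_\infty:=\max_{z\in\mathbb P^n}\max_i|f_i(z)|,\qquad \mathbf M(f,z):=\sqrt n\,\|f\|_\infty\,\|(D_zf)^{-1}\Delta\|,$$ where $D_zf:z^\perp\to\mathbb C^n$ is the derivative of $f$ at $z$ restricted to $z^\perp=T_z\mathbb P^n$, $\|\cdot\|$ is the operator norm for the Euclidean norms, and $\mathbf M(f,z):=\infty$ if $D_zf$ is not invertible. Newton's operator $N_f(z):=[\,z-(D_zf)^{-1}f(z)\,]$ is defined when $D_zf$ is invertible. A point $z$ is an approximate zero of $f$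 with associated zero $\zeta$ if $f(\zeta)=0$ and, for all $k\ge 0$, the iterate $N_f^k(z)$ is defined and $\mathrm{dist}_{\mathbb P}(N_f^k(z),\zeta)\le(1/2)^{2^k-1}\,\mathrm{dist}_{\mathbb P}(z,\zeta)$. Let $f,g\in\mathcal H_d[n]$, $\zeta\in\mathbb P^n$ with $g(\zeta)=0$, and $q_t:=tf+(1-t)g$ for $t\in[0,1]$. The algorithm $\mathrm{ALH}_\infty$ with input $(f,g,\zeta)$ sets $t\leftarrow 0$, $q\leftarrow g$, $z\leftarrow\zeta$, and repeats the step $$\Delta t\leftarrow\frac{0.03\,\|q\|_\infty}{\|f-g\|_\infty\,\mathbf D\,\mathbf M^2(q,z)},\qquad t\leftarrow\min\{t+\Delta t,1\},\qquad q\leftarrow q_t,\qquad z\leftarrow N_q(z)$$ until $t=1$; then it returns $z$. (If $f=g\neq 0$ and $\mathbf M(q,z)<\infty$, then $\Delta t=\infty$.) **Theorem.** Suppose that the segment $[g,f]$ lifts to a continuous path $(q_t,\zeta_t)$, $t\in[0,1]$, in $\{(h,\eta)\in\mathcal H_d[n]\times\mathbb P^n: h(\eta)=0\}$ with $\zeta_0=\zeta$,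 and that $D_{\zeta_t}q_t$ is invertible for all $t\in[0,1]$. Then the integral below is finite, all operations of $\mathrm{ALH}_\infty$ on input $(f,g,\zeta)$ are defined, and the algorithm stops after a number $K$ of steps with $$K\le 1+45\,\mathbf D\,\|f-g\|_\infty\int_0^1\frac{\mathbf M^2(q_t,\zeta_t)}{\|q_t\|_\infty}\,dt .$$ The point $z$ that it returns is an approximate zero of $f$ with associated zero $\zeta_1$. -/

import Mathlib

open scoped ENNReal

noncomputable section

namespace LinearHomotopy

/-- The Hermitian space `ℂⁿ⁺¹` with its Euclidean norm. -/
abbrev Cvec (n : ℕ) : Type := EuclideanSpace ℂ (Fin (n + 1))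

/-- Complex projective space `ℙⁿ`. -/
abbrev CProj (n : ℕ) : Type := Projectivization ℂ (Cvec n)

/-- The space of systems of `n` complex homogeneous polynomials in the `n + 1` variables
`X₀, …, Xₙ`, the `i`-th one of degree `d i`. -/
abbrev HomSys (n : ℕ) (d : Fin n → ℕ) : Type :=
  (i : Fin n) → MvPolynomial.homogeneousSubmodule (Fin (n + 1)) ℂ (d i)

/-- The maximal degree `D`. -/
def maxDeg {n : ℕ} (d : Fin n → ℕ) : ℕ := Finset.univ.sup d

variable {n : ℕ} {d : Fin n → ℕ}

/-- The evaluation `f(x) = (f₁(x), …, fₙ(x))`. -/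
def evalSys (f : HomSys n d) (x : Cvec n) : EuclideanSpace ℂ (Fin n) :=
  WithLp.toLp 2 fun i => MvPolynomial.eval x.ofLp (f i : MvPolynomial (Fin (n + 1)) ℂ)

/-- The complex `L_∞`-norm `‖f‖_∞ = max_{‖x‖ = 1} max_i |fᵢ(x)|`
(`‖·‖` of an element of `Fin n → ℂ` is the maximum norm). -/
def supNorm (f : HomSys n d) : ℝ :=
  ⨆ x : Metric.sphere (0 : Cvec n) 1, ‖(evalSys f x).ofLp‖

/-- The tangent space `T_x ℙⁿ` at (the class of) `x`: the orthogonal complement of `x`. -/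
abbrev Tangent (x : Cvec n) : Submodule ℂ (Cvec n) := (Submodule.span ℂ {x})ᗮ

/-- `D_x f : T_x ℙⁿ → ℂⁿ`, the derivative of `f` at `x` restricted to the tangent space. -/
def tangentDeriv (f : HomSys n d) (x : Cvec n) :
    Tangent x →L[ℂ] EuclideanSpace ℂ (Fin n) :=
  (fderiv ℂ (evalSys f) x).comp (Tangent x).subtypeL

/-- The diagonal map `Δ = diag(d₁, …, dₙ)`. -/
def degDiag (d : Fin n → ℕ) : EuclideanSpace ℂ (Fin n) →L[ℂ] EuclideanSpace ℂ (Fin n) :=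
  Matrix.toEuclideanCLM (𝕜 := ℂ) (Matrix.diagonal fun i => (d i : ℂ))

open Classical in
/-- The condition number `M(f, x) = √n ‖f‖_∞ ‖(D_x f)⁻¹ Δ‖` at a unit vector `x`, with value `∞`
where `D_x f` is not invertible. As there are as many equations as tangent
directions, the Moore–Penrose inverse of a surjective `D_x f` is its inverse. -/
def condVec (f : HomSys n d) (x : Cvec n) : ℝ≥0∞ :=
  if (tangentDeriv f x).IsInvertible then
    ENNReal.ofReal (Real.sqrt n * supNorm f * ‖(tangentDeriv f x).inverse ∘L degDiag d‖)
  else ⊤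

/-- The vector `x - (D_x f)⁻¹ f(x)`, for a nonzero vector `x` at which `D_x f` is invertible. -/
def newtonVec (f : HomSys n d) (x : Cvec n) : Cvec n :=
  x - ((tangentDeriv f x).inverse (evalSys f x) : Cvec n)

theorem newtonVec_ne_zero (f : HomSys n d) {x : Cvec n} (hx : x ≠ 0) :
    newtonVec f x ≠ 0 := by
  intro h
  have hm := ((tangentDeriv f x).inverse (evalSys f x)).2
  rw [← sub_eq_zero.mp h, Submodule.mem_orthogonal_singleton_iff_inner_right] at hm
  exact hx (inner_self_eq_zero.mp hm)

/-- A representative of norm one of a point of `ℙⁿ`. Everything that is defined below through it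
depends only on the point: representatives of norm one differ by a phase. -/
def unitRep (z : CProj n) : Cvec n := ((‖z.rep‖⁻¹ : ℝ) : ℂ) • z.rep

theorem unitRep_ne_zero (z : CProj n) : unitRep z ≠ 0 :=
  smul_ne_zero
    (Complex.ofReal_ne_zero.mpr (inv_ne_zero (norm_ne_zero_iff.mpr z.rep_nonzero))) z.rep_nonzero

/-- `f(z) = 0`. -/
def IsZeroAt (f : HomSys n d) (z : CProj n) : Prop := evalSys f (unitRep z) = 0

/-- `D_z f` is invertible; the pairs `(f, z)` with `f(z) = 0` for which this fails make up the
singular locus of the solution variety. -/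
def IsNonsingularAt (f : HomSys n d) (z : CProj n) : Prop :=
  (tangentDeriv f (unitRep z)).IsInvertible

/-- The condition number `M(f, z)` at a point `z ∈ ℙⁿ`. -/
def cond (f : HomSys n d) (z : CProj n) : ℝ≥0∞ := condVec f (unitRep z)

/-- The geodesic distance (angle) on `ℙⁿ`. -/
def distP (z w : CProj n) : ℝ :=
  Real.arccos (‖(inner ℂ (unitRep z) (unitRep w) : ℂ)‖)

open Classical in
/-- Newton's operator `N_f` on `ℙⁿ`: the class of `z - (D_z f)⁻¹ f(z)`; undefined (`none`) where
`D_z f` is not invertible. -/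
def newton (f : HomSys n d) (z : CProj n) : Option (CProj n) :=
  if IsNonsingularAt f z then
    some (Projectivization.mk ℂ (newtonVec f (unitRep z))
      (newtonVec_ne_zero f (unitRep_ne_zero z)))
  else none

/-- The `k`-th iterate of Newton's operator, undefined as soon as one of the steps is. -/
def newtonIter (f : HomSys n d) : ℕ → CProj n → Option (CProj n)
  | 0, z => some z
  | k + 1, z => (newtonIter f k z).bind (newton f)

/-- `z` is an approximate zero of `f` with associated zero `ζ`: all Newton iterates of `z` are
defined, and they converge to `ζ` at the quadratic rate `(1/2)^(2^k - 1)`. -/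
def IsApproxZero (f : HomSys n d) (z ζ : CProj n) : Prop :=
  IsZeroAt f ζ ∧
    ∀ k : ℕ, ∃ w, newtonIter f k z = some w ∧
      distP w ζ ≤ (1 / 2 : ℝ) ^ (2 ^ k - 1) * distP z ζ

/-- The point `q_t = t f + (1 - t) g` of the segment from `g` to `f`. -/
def seg (f g : HomSys n d) (t : ℝ) : HomSys n d := (t : ℂ) • f + ((1 - t : ℝ) : ℂ) • g

/-- `t ↦ (q_t, γ t)`, `t ∈ [0, 1]`, is the lifting of the segment from `g` to `f` to the solution
variety that starts at `ζ`: `γ` is continuous, `γ 0 = ζ`, and `q_t(γ t) = 0`. -/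
structure IsLifting (f g : HomSys n d) (ζ : CProj n) (γ : ℝ → CProj n) : Prop where
  start : γ 0 = ζ
  zero : ∀ t ∈ Set.Icc (0 : ℝ) 1, IsZeroAt (seg f g t) (γ t)
  cont : ∀ t ∈ Set.Icc (0 : ℝ) 1,
    Filter.Tendsto (fun s => distP (γ s) (γ t)) (nhdsWithin t (Set.Icc 0 1)) (nhds 0)

/-- The step length `Δt = 0.03 ‖q‖_∞ / (‖f - g‖_∞ D M²(q, z))`, where `q = q_t`. It is computed in
`[0, ∞]`: it is `∞` if `f = g` (and `q ≠ 0`), and `0` if `f ≠ g` and `M(q, z) = ∞`. -/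
def stepLength (f g : HomSys n d) (t : ℝ) (z : CProj n) : ℝ≥0∞ :=
  ENNReal.ofReal (0.03 * supNorm (seg f g t)) /
    (ENNReal.ofReal (supNorm (f - g)) * (maxDeg d : ℝ≥0∞) * cond (seg f g t) z ^ 2)

/-- The updated parameter `min {t + Δt, 1}`. -/
def nextTime (f g : HomSys n d) (t : ℝ) (z : CProj n) : ℝ :=
  (min (ENNReal.ofReal t + stepLength f g t z) 1).toReal

/-- `LoopRun f g t z K w`: the loop
`repeat (t ← min {t + Δt, 1}; q ← t f + (1 - t) g; z ← N_q(z)) until t = 1`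
entered with the values `t` and `z` is executed exactly `K` times, all its operations being
defined, and then halts with the value `w` of `z`. -/
inductive LoopRun (f g : HomSys n d) : ℝ → CProj n → ℕ → CProj n → Prop
  | halt {t : ℝ} {z w : CProj n} (ht : nextTime f g t z = 1)
      (hw : newton (seg f g (nextTime f g t z)) z = some w) : LoopRun f g t z 1 w
  | next {t : ℝ} {z z' w : CProj n} {K : ℕ} (ht : nextTime f g t z ≠ 1)
      (hz : newton (seg f g (nextTime f g t z)) z = some z')
      (hr : LoopRun f g (nextTime f g t z) z' K w) : LoopRun f g t z (K + 1) w

/-- On input `f, g, ζ` the algorithm `ALH_∞` stops after exactly `K` steps and returns `w`. -/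
def ALHInfty (f g : HomSys n d) (ζ : CProj n) (K : ℕ) (w : CProj n) : Prop :=
  LoopRun f g 0 ζ K w

/-- The integral `∫₀¹ M²(q_t, γ t) / ‖q_t‖_∞ dt`, as an element of `[0, ∞]`. -/
def condIntegral (f g : HomSys n d) (γ : ℝ → CProj n) : ℝ≥0∞ :=
  ∫⁻ t in Set.Icc (0 : ℝ) 1,
    cond (seg f g t) (γ t) ^ 2 / ENNReal.ofReal (supNorm (seg f g t))

end LinearHomotopy

end

open LinearHomotopy

noncomputable section

namespace LinearHomotopy

/-! ### Cauchy estimates for homogeneous functions near the unit sphere. -/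

section CauchyEstimates

variable {E : Type*} [NormedAddCommGroup E] [InnerProductSpace ℂ E]

/-! Let D be the maximal degree and M the condition number at the current approximation z of the
exact zero ζ_t. If z + h, with h ⟂ z, spans the line of ζ_t, the loop invariant `Tracks` is D·M·‖h‖
≤ 0.003. The step length means D·M²·‖Δq‖_∞ ≤ 0.03‖q‖_∞ (`ShortStep`), a perturbation that the
inverse derivative absorbs.

Analytic input: Cauchy's inequality on complex lines tangent to the sphere bounds Δ⁻¹Df by √n‖f‖_∞
and its change under a tangent displacement h by 1.6·D·‖h‖ times that (`norm_scaledDeriv_le`,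
`norm_scaledDeriv_sub_le`). So M ≥ 1, and every estimate can be written in terms of X = D·M·‖h‖.

Confinement: subtracting the Taylor expansions of the old and the new system gives a quadratic
inequality for X that fails at X = 0.037 (`StepData.radius_ne`). As ζ_t moves continuously, X stays
below this barrier during the step (`Tracks.chart_le`). One Newton step for the new system squares
the error and restores 0.003 (`StepData.newton`).

Counting: during a step the integrand M²/‖q‖_∞ on the path is at least 1/1.25 of its value at the
approximation (`Tracks.le_integrand`). A step that is not the last has full length, so it consumes
at least 45·0.03/1.25 = 1.08 ≥ 1 of the bound; `exists_loopRun` adds this up. Finiteness comes from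
local bounds and compactness (`condIntegral_ne_top`). At t = 1 the invariant gives quadratic
convergence (`isApproxZero_of_chartVec`). -/

theorem deriv_line {F : E → ℂ} (hF : Differentiable ℂ F) (a v : E) (s : ℂ) :
    HasDerivAt (fun b : ℂ => F (a + b • v)) (fderiv ℂ F (a + s • v) v) s := by
  have h1 : HasDerivAt (fun b : ℂ => a + b • v) v s := by
    simpa using ((hasDerivAt_id s).smul_const v).const_add a
  exact (hF (a + s • v)).hasFDerivAt.comp_hasDerivAt s h1

theorem norm_fderiv_apply_le {F : E → ℂ} (hF : Differentiable ℂ F) (a v : E) {r C : ℝ}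
    (hr : 0 < r) (hC : ∀ b : ℂ, ‖b‖ = r → ‖F (a + b • v)‖ ≤ C) :
    ‖fderiv ℂ F a v‖ ≤ C / r := by
  have h := deriv_line hF a v
  have hd : Differentiable ℂ (fun b : ℂ => F (a + b • v)) := fun s => (h s).differentiableAt
  have := Complex.norm_deriv_le_of_forall_mem_sphere_norm_le (c := 0) hr hd.diffContOnCl
    (fun b hb => hC b (by simpa using hb))
  simpa [(h 0).deriv] using this

theorem norm_add_orthogonal {z w : E} (hz : ‖z‖ = 1) (hw : inner ℂ z w = 0) :
    ‖z + w‖ = √(1 + ‖w‖ ^ 2) := by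
  rw [eq_comm, Real.sqrt_eq_iff_mul_self_eq (by positivity) (norm_nonneg _),
    norm_add_sq_eq_norm_sq_add_norm_sq_of_inner_eq_zero z w hw, hz]
  ring

theorem one_add_inv_pow_le (m : ℕ) (hm : 1 ≤ m) : (1 + 1 / (m : ℝ)) ^ m ≤ m + 1 := by
  have hm0 : (0 : ℝ) < m := by exact_mod_cast hm
  rcases hm.eq_or_lt with rfl | h2
  · norm_num
  have h1 : 1 + 1 / (m : ℝ) ≤ Real.exp (1 / m) := by
    have := Real.add_one_le_exp (1 / (m : ℝ)); linarith
  calc (1 + 1 / (m : ℝ)) ^ m ≤ Real.exp (1 / m) ^ m := by gcongr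
    _ = Real.exp 1 := by rw [← Real.exp_nat_mul]; congr 1; field_simp
    _ ≤ m + 1 := by
      have := Real.exp_one_lt_d9
      have : (2 : ℝ) ≤ m := by exact_mod_cast h2
      linarith

/-- The derivative of a homogeneous function of degree `k` in directions tangent to the sphere. -/
theorem norm_fderiv_tangent_le {F : E → ℂ} (hF : Differentiable ℂ F) {B : ℝ} (hB0 : 0 ≤ B)
    {k : ℕ} (hk : 1 ≤ k) (hB : ∀ x, ‖F x‖ ≤ B * ‖x‖ ^ k) {z v : E} (hz : ‖z‖ = 1)
    (hv : inner ℂ z v = 0) : ‖fderiv ℂ F z v‖ ≤ k * B * ‖v‖ := by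
  have key : ∀ e : E, ‖e‖ = 1 → inner ℂ z e = 0 → ‖fderiv ℂ F z e‖ ≤ k * B := by
    intro e he hze
    have hr : ∀ r : ℝ, 0 < r → ‖fderiv ℂ F z e‖ ≤ B * √(1 + r ^ 2) ^ k / r := by
      intro r hr
      refine norm_fderiv_apply_le hF z e hr fun b hb => (hB _).trans ?_
      rw [norm_add_orthogonal hz (by rw [inner_smul_right, hze, mul_zero]), norm_smul, he, hb,
        mul_one]
    -- The factor (1 + r²)^(k/2)/r is minimal at r = 1/√(k-1) if k ≥ 2. For k = 1 its infimum is
    -- approached only as r → ∞, hence the argument by contradiction with an explicit large r.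
    rcases hk.eq_or_lt with rfl | h2
    · set c := ‖fderiv ℂ F z e‖
      by_contra! hc
      simp only [Nat.cast_one, one_mul] at hc
      have hc0 : 0 ≤ c := norm_nonneg _
      have hpos : 0 < c ^ 2 - B ^ 2 := by nlinarith
      set r := √((B ^ 2 + 1) / (c ^ 2 - B ^ 2))
      have hrpos : 0 < r := Real.sqrt_pos.mpr (by positivity)
      have hr2 : r ^ 2 * (c ^ 2 - B ^ 2) = B ^ 2 + 1 := by
        rw [Real.sq_sqrt (by positivity)]; field_simp
      have h := hr r hrpos
      rw [le_div_iff₀ hrpos, pow_one] at h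
      have h3 := mul_self_le_mul_self (by positivity) h
      have h4 : √(1 + r ^ 2) * √(1 + r ^ 2) = 1 + r ^ 2 := Real.mul_self_sqrt (by positivity)
      nlinarith
    · obtain ⟨m, rfl⟩ : ∃ m, k = m + 1 := ⟨k - 1, by omega⟩
      have hm : 1 ≤ m := by omega
      have hm0 : (0 : ℝ) < m := by exact_mod_cast hm
      have h := hr (√(m : ℝ))⁻¹ (by positivity)
      refine h.trans ?_
      rw [div_inv_eq_mul, mul_assoc, mul_comm _ B]
      gcongr
      refine (sq_le_sq₀ (by positivity) (by positivity)).mp ?_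
      rw [mul_pow, ← pow_mul, mul_comm (m + 1) 2, pow_mul, Real.sq_sqrt (by positivity),
        Real.sq_sqrt hm0.le, inv_pow, Real.sq_sqrt hm0.le]
      have := one_add_inv_pow_le m hm
      rw [one_div] at this
      push_cast
      calc (1 + (m : ℝ)⁻¹) ^ (m + 1) * m = (1 + (m : ℝ)⁻¹) ^ m * (m + 1) := by
            rw [pow_succ]; field_simp
        _ ≤ (m + 1) * (m + 1) := by gcongr
        _ = (m + 1 : ℝ) ^ 2 := by ring
  rcases eq_or_ne v 0 with rfl | hv0
  · simp
  have hvn : ‖v‖ ≠ 0 := norm_ne_zero_iff.mpr hv0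
  have h := key (((‖v‖⁻¹ : ℝ) : ℂ) • v)
    (by rw [norm_smul, Complex.norm_real, norm_inv, norm_norm, inv_mul_cancel₀ hvn])
    (by rw [inner_smul_right, hv, mul_zero])
  rw [map_smul, norm_smul, Complex.norm_real, norm_inv, norm_norm,
    inv_mul_le_iff₀ (by positivity)] at h
  linarith

theorem sqrt_pow_le_of_pow_le {a c : ℝ} (k : ℕ) (ha : 0 ≤ a) (hc : 0 ≤ c) (h : a ^ k ≤ c ^ 2) :
    √a ^ k ≤ c := by
  refine (sq_le_sq₀ (by positivity) hc).mp ?_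
  rwa [← pow_mul, mul_comm, pow_mul, Real.sq_sqrt ha]

/-- This is the Cauchy factor at radius 1/√k: 4.17 exceeds (2 + 0.04)². For k ≥ 6 it is at most
e^4.5 ≤ 91 < 9.6². -/
theorem one_add_div_pow_le (k : ℕ) (hk : 2 ≤ k) :
    (1 + 4.17 / (k : ℝ)) ^ k ≤ (1.6 * k) ^ 2 := by
  rcases lt_or_ge k 6 with h | h
  · interval_cases k <;> norm_num
  have hk0 : (6 : ℝ) ≤ k := by exact_mod_cast h
  have h1 : 1 + 4.17 / (k : ℝ) ≤ Real.exp (4.17 / k) := by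
    have := Real.add_one_le_exp (4.17 / (k : ℝ)); linarith
  calc (1 + 4.17 / (k : ℝ)) ^ k ≤ Real.exp (4.17 / k) ^ k := by gcongr
    _ = Real.exp 4.17 := by rw [← Real.exp_nat_mul]; congr 1; field_simp
    _ ≤ Real.exp 4.5 := by gcongr; norm_num
    _ ≤ 91 := by
      refine (sq_le_sq₀ (by positivity) (by norm_num)).mp ?_
      have h9 : Real.exp 4.5 ^ 2 = Real.exp 1 ^ 9 := by
        rw [← Real.exp_nat_mul, ← Real.exp_nat_mul]; norm_num
      rw [h9]
      calc Real.exp 1 ^ 9 ≤ 2.7182818286 ^ 9 := by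
            gcongr; exact Real.exp_one_lt_d9.le
        _ ≤ 91 ^ 2 := by norm_num
    _ ≤ (1.6 * k) ^ 2 := by nlinarith

/-- For a homogeneous function, the derivative is Lipschitz near a point of the unit sphere in the
affine chart given by the tangent space. -/
theorem norm_fderiv_sub_fderiv_le {F : E → ℂ} (hF : ContDiff ℂ 2 F) {B : ℝ} (hB0 : 0 ≤ B)
    {k : ℕ} (hk : 1 ≤ k) (hB : ∀ x, ‖F x‖ ≤ B * ‖x‖ ^ k) {z h v : E} (hz : ‖z‖ = 1)
    (hh : inner ℂ z h = 0) (hv : inner ℂ z v = 0) (hsmall : k * ‖h‖ ≤ 0.04) :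
    ‖fderiv ℂ F (z + h) v - fderiv ℂ F z v‖ ≤ 1.6 * k ^ 2 * B * ‖h‖ * ‖v‖ := by
  have hk0 : (1 : ℝ) ≤ k := by exact_mod_cast hk
  have hFd : Differentiable ℂ F := hF.differentiable (by norm_num)
  have key : ∀ e w : E, ‖e‖ = 1 → ‖w‖ = 1 → inner ℂ z e = 0 → inner ℂ z w = 0 →
      ‖fderiv ℂ F (z + (‖h‖ : ℂ) • e) w - fderiv ℂ F z w‖ ≤ 1.6 * k ^ 2 * B * ‖h‖ := by
    intro e w he hw hze hzw
    -- Two Cauchy estimates of the same radius r: one in direction w bounds ψ on the disc of radius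
    -- ‖h‖ + r, the second then bounds ψ' on the disc of radius ‖h‖.
    set ψ : ℂ → ℂ := fun a => fderiv ℂ F (z + a • e) w with hψ
    have hψd : Differentiable ℂ ψ := by
      have h1 : ContDiff ℂ 1 (fderiv ℂ F) := hF.fderiv_right (by norm_num)
      have h2 := h1.differentiable (by norm_num)
      intro a
      have h3 : DifferentiableAt ℂ (fun a : ℂ => z + a • e) a := by fun_prop
      exact ((h2 _).comp a h3).clm_apply (differentiableAt_const w)
    obtain ⟨r, hr, hrB⟩ : ∃ r : ℝ, 0 < r ∧
        √(1 + (‖h‖ + r + r) ^ 2) ^ k ≤ 1.6 * k ^ 2 * (r * r) := by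
      rcases hk.eq_or_lt with rfl | h2
      · refine ⟨10, by norm_num, ?_⟩
        simp only [Nat.cast_one, pow_one, one_mul] at hsmall ⊢
        rw [Real.sqrt_le_left (by norm_num)]
        nlinarith [norm_nonneg h]
      · refine ⟨(√(k : ℝ))⁻¹, by positivity, ?_⟩
        have hsq : √(k : ℝ) * √(k : ℝ) = k := Real.mul_self_sqrt (by positivity)
        rw [← mul_inv, hsq]
        refine sqrt_pow_le_of_pow_le k (by positivity) (by positivity) ?_
        have h3 : 1.6 * (k : ℝ) ^ 2 * (k : ℝ)⁻¹ = 1.6 * k := by field_simp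
        rw [h3]
        refine le_trans ?_ (one_add_div_pow_le k h2)
        gcongr
        set q := (√(k : ℝ))⁻¹ with hq
        have hq2 : q * q = 1 / k := by rw [hq, ← mul_inv, hsq, one_div]
        have hq0 : 0 < q := by positivity
        have hq1 : q ≤ 1 := by
          have : (1 : ℝ) ≤ √(k : ℝ) := Real.one_le_sqrt.mpr hk0
          exact inv_le_one_of_one_le₀ this
        have hhk : ‖h‖ ≤ 0.04 * (q * q) := by
          rw [hq2, mul_one_div, le_div_iff₀ (by positivity)]; linarith
        have hhq : ‖h‖ ≤ 0.04 * q := by nlinarith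
        have : 4.17 / (k : ℝ) = 4.17 * (q * q) := by rw [hq2]; ring
        rw [this]
        nlinarith [norm_nonneg h]
    set C := B * √(1 + (‖h‖ + r + r) ^ 2) ^ k with hC
    have hψb : ∀ a : ℂ, ‖a‖ ≤ ‖h‖ + r → ‖ψ a‖ ≤ C / r := by
      intro a ha
      refine norm_fderiv_apply_le hFd _ w hr fun b hb => (hB _).trans ?_
      rw [add_assoc, norm_add_orthogonal hz
        (by rw [inner_add_right, inner_smul_right, inner_smul_right, hze, hzw]; simp), hC]
      have : ‖a • e + b • w‖ ≤ ‖h‖ + r + r := by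
        refine (norm_add_le _ _).trans ?_
        rw [norm_smul, norm_smul, he, hw, hb]; linarith
      gcongr
    have hψ' : ∀ a ∈ Metric.closedBall (0 : ℂ) ‖h‖, ‖deriv ψ a‖ ≤ C / r / r := by
      intro a ha
      refine Complex.norm_deriv_le_of_forall_mem_sphere_norm_le hr hψd.diffContOnCl
        fun b hb => hψb b ?_
      have h1 : ‖a‖ ≤ ‖h‖ := by simpa using ha
      have h2 : ‖b - a‖ = r := by simpa [dist_eq_norm] using hb
      have := norm_add_le a (b - a)
      rw [add_sub_cancel] at this
      linarith
    have h0 := (convex_closedBall (0 : ℂ) ‖h‖).norm_image_sub_le_of_norm_deriv_le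
      (fun a _ => hψd a) hψ' (x := 0) (y := (‖h‖ : ℂ)) (by simp) (by simp)
    simp only [hψ, zero_smul, add_zero, sub_zero, Complex.norm_real, norm_norm] at h0
    refine h0.trans ?_
    have : C / r / r ≤ 1.6 * k ^ 2 * B := by
      rw [div_div, div_le_iff₀ (by positivity), hC]
      nlinarith
    gcongr
  rcases eq_or_ne h 0 with rfl | hh0
  · simp
  rcases eq_or_ne v 0 with rfl | hv0
  · simp
  have hvn : ‖v‖ ≠ 0 := norm_ne_zero_iff.mpr hv0
  have hhn : ‖h‖ ≠ 0 := norm_ne_zero_iff.mpr hh0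
  have hun : ∀ u : E, ‖u‖ ≠ 0 → ‖((‖u‖⁻¹ : ℝ) : ℂ) • u‖ = 1 := fun u hu => by
    rw [norm_smul, Complex.norm_real, norm_inv, norm_norm, inv_mul_cancel₀ hu]
  have h1 := key (((‖h‖⁻¹ : ℝ) : ℂ) • h) (((‖v‖⁻¹ : ℝ) : ℂ) • v) (hun h hhn) (hun v hvn)
    (by rw [inner_smul_right, hh, mul_zero]) (by rw [inner_smul_right, hv, mul_zero])
  rw [smul_smul, ← Complex.ofReal_mul, mul_inv_cancel₀ hhn, Complex.ofReal_one, one_smul,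
    map_smul, map_smul, ← smul_sub, norm_smul, Complex.norm_real, norm_inv, norm_norm,
    inv_mul_le_iff₀ (by positivity)] at h1
  linarith

/-- Mean value inequality for s ↦ F(z + sh) - s·DF(z)h on the unit disc. The usual factor 1/2 is
given away. -/
theorem norm_taylor_remainder_le {F : E → ℂ} (hF : ContDiff ℂ 2 F) {B : ℝ} (hB0 : 0 ≤ B)
    {k : ℕ} (hk : 1 ≤ k) (hB : ∀ x, ‖F x‖ ≤ B * ‖x‖ ^ k) {z h : E} (hz : ‖z‖ = 1)
    (hh : inner ℂ z h = 0) (hsmall : k * ‖h‖ ≤ 0.04) :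
    ‖F (z + h) - F z - fderiv ℂ F z h‖ ≤ 1.6 * k ^ 2 * B * ‖h‖ ^ 2 := by
  have hFd : Differentiable ℂ F := hF.differentiable (by norm_num)
  set G : ℂ → ℂ := fun s => F (z + s • h) - s * fderiv ℂ F z h with hG
  have hGd : ∀ s, HasDerivAt G (fderiv ℂ F (z + s • h) h - fderiv ℂ F z h) s := fun s => by
    have h1 := (deriv_line hFd z h s).sub ((hasDerivAt_id s).mul_const (fderiv ℂ F z h))
    rw [one_mul] at h1
    exact h1
  have hb : ∀ s ∈ Metric.closedBall (0 : ℂ) 1,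
      ‖fderiv ℂ F (z + s • h) h - fderiv ℂ F z h‖ ≤ 1.6 * k ^ 2 * B * ‖h‖ * ‖h‖ := by
    intro s hs
    have hs1 : ‖s • h‖ ≤ ‖h‖ := by
      rw [norm_smul]
      have : ‖s‖ ≤ 1 := by simpa using hs
      nlinarith [norm_nonneg h]
    refine (norm_fderiv_sub_fderiv_le hF hB0 hk hB hz
      (by rw [inner_smul_right, hh, mul_zero]) hh ?_).trans (by gcongr)
    refine le_trans ?_ hsmall
    gcongr
  have h0 := (convex_closedBall (0 : ℂ) 1).norm_image_sub_le_of_norm_hasDerivWithin_le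
    (fun s _ => (hGd s).hasDerivWithinAt) hb (x := 0) (y := 1) (by simp) (by simp)
  simp only [hG, zero_smul, add_zero, one_smul, one_mul, zero_mul, sub_zero, norm_one,
    mul_one] at h0
  calc _ = ‖F (z + h) - fderiv ℂ F z h - F z‖ := by congr 1; ring
    _ ≤ _ := h0
    _ = _ := by ring

end CauchyEstimates

variable {n : ℕ} {d : Fin n → ℕ}

/-! ### Homogeneity and Euler's identity for systems. -/

section Evaluation

theorem evalSys_apply (f : HomSys n d) (x : Cvec n) (i : Fin n) :
    evalSys f x i = MvPolynomial.eval x.ofLp (f i : MvPolynomial (Fin (n + 1)) ℂ) := rfl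

theorem evalSys_add (f g : HomSys n d) (x : Cvec n) :
    evalSys (f + g) x = evalSys f x + evalSys g x := by
  ext i; simp [evalSys]

theorem evalSys_smul (c : ℂ) (f : HomSys n d) (x : Cvec n) :
    evalSys (c • f) x = c • evalSys f x := by
  ext i; simp [evalSys]

theorem evalSys_sub (f g : HomSys n d) (x : Cvec n) :
    evalSys (f - g) x = evalSys f x - evalSys g x := by
  ext i; simp [evalSys]

theorem contDiff_evalSys_apply (f : HomSys n d) (i : Fin n) :
    ContDiff ℂ 2 (fun x => evalSys f x i) := by
  have h := AnalyticOnNhd.eval_continuousLinearMap (𝕜 := ℂ)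
    (EuclideanSpace.equiv (Fin (n + 1)) ℂ : Cvec n →L[ℂ] Fin (n + 1) → ℂ)
    (f i : MvPolynomial (Fin (n + 1)) ℂ)
  have h2 : ContDiffOn ℂ 2 (fun x => evalSys f x i) Set.univ := h.contDiffOn uniqueDiffOn_univ
  exact contDiffOn_univ.mp h2

theorem contDiff_evalSys (f : HomSys n d) : ContDiff ℂ 2 (evalSys f) :=
  contDiff_euclidean.mpr (contDiff_evalSys_apply f)

theorem differentiable_evalSys (f : HomSys n d) : Differentiable ℂ (evalSys f) :=
  (contDiff_evalSys f).differentiable (by norm_num)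

theorem fderiv_evalSys_apply (f : HomSys n d) (x v : Cvec n) (i : Fin n) :
    fderiv ℂ (evalSys f) x v i = fderiv ℂ (fun y => evalSys f y i) x v := by
  have h := (EuclideanSpace.proj (𝕜 := ℂ) i).hasFDerivAt.comp x
    (differentiable_evalSys f x).hasFDerivAt
  exact (DFunLike.congr_fun h.fderiv v).symm

theorem evalSys_smul_apply (f : HomSys n d) (c : ℂ) (x : Cvec n) (i : Fin n) :
    evalSys f (c • x) i = c ^ d i * evalSys f x i := by
  have hf := (MvPolynomial.mem_homogeneousSubmodule _ _).mp (f i).2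
  rw [evalSys_apply, evalSys_apply, MvPolynomial.eval_eq', MvPolynomial.eval_eq', Finset.mul_sum]
  refine Finset.sum_congr rfl fun m hm => ?_
  have hdeg : ∑ j, m j = d i := by
    have := hf (MvPolynomial.mem_support_iff.mp hm)
    rw [← this, Finsupp.weight_apply, Finsupp.sum_fintype] <;> simp
  have h1 : ∏ j, ((c • x).ofLp j) ^ m j = c ^ d i * ∏ j, (x.ofLp j) ^ m j := by
    rw [← hdeg, ← Finset.prod_pow_eq_pow_sum, ← Finset.prod_mul_distrib]
    refine Finset.prod_congr rfl fun j _ => ?_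
    simp [mul_pow]
  rw [h1]; ring

/-- Differentiate b ↦ F(cx + bcv) at 0 by the chain rule and by homogeneity, then cancel one factor
c. -/
theorem fderiv_evalSys_smul_apply (f : HomSys n d) (hd : ∀ i, 1 ≤ d i) {c : ℂ} (hc : c ≠ 0)
    (x v : Cvec n) (i : Fin n) :
    fderiv ℂ (evalSys f) (c • x) v i = c ^ (d i - 1) * fderiv ℂ (evalSys f) x v i := by
  rw [fderiv_evalSys_apply, fderiv_evalSys_apply]
  have hF := (contDiff_evalSys_apply f i).differentiable (by norm_num)
  have h1 : HasDerivAt (fun b : ℂ => evalSys f (c • x + b • (c • v)) i)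
      (fderiv ℂ (fun y => evalSys f y i) (c • x) (c • v)) 0 := by
    simpa using deriv_line hF (c • x) (c • v) 0
  have h2 : HasDerivAt (fun b : ℂ => evalSys f (c • x + b • (c • v)) i)
      (c ^ d i * fderiv ℂ (fun y => evalSys f y i) x v) 0 := by
    have := (deriv_line hF x v 0).const_mul (c ^ d i)
    rw [zero_smul, add_zero] at this
    refine this.congr_of_eventuallyEq (Filter.Eventually.of_forall fun b => ?_)
    show _ = c ^ d i * evalSys f (x + b • v) i
    rw [← evalSys_smul_apply, smul_add, smul_comm c b v]
  have h3 := h1.unique h2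
  rw [map_smul, smul_eq_mul] at h3
  obtain ⟨m, hm⟩ : ∃ m, d i = m + 1 := ⟨d i - 1, by have := hd i; omega⟩
  rw [hm, pow_succ'] at h3
  rw [hm, Nat.add_sub_cancel]
  exact mul_left_cancel₀ hc (by rw [h3]; ring)

/-- Euler's identity. At a zero it says that the derivative kills the radial direction, so only
tangent directions matter there. -/
theorem fderiv_evalSys_self_apply (f : HomSys n d) (x : Cvec n) (i : Fin n) :
    fderiv ℂ (evalSys f) x x i = d i * evalSys f x i := by
  rw [fderiv_evalSys_apply]
  have hF := (contDiff_evalSys_apply f i).differentiable (by norm_num)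
  have h1 : HasDerivAt (fun b : ℂ => evalSys f (x + b • x) i)
      (fderiv ℂ (fun y => evalSys f y i) x x) 0 := by
    simpa using deriv_line hF x x 0
  have h2 : HasDerivAt (fun b : ℂ => evalSys f (x + b • x) i) (d i * evalSys f x i) 0 := by
    have h3 : HasDerivAt (fun b : ℂ => (1 + b) ^ d i * evalSys f x i) (d i * evalSys f x i) 0 := by
      have := (((hasDerivAt_id (0 : ℂ)).const_add 1).pow (d i)).mul_const (evalSys f x i)
      simpa using this
    refine h3.congr_of_eventuallyEq (Filter.Eventually.of_forall fun b => ?_)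
    show _ = (1 + b) ^ d i * evalSys f x i
    rw [← evalSys_smul_apply, add_smul, one_smul]
  exact h1.unique h2

theorem fderiv_evalSys_sub (f g : HomSys n d) (x : Cvec n) :
    fderiv ℂ (evalSys (f - g)) x = fderiv ℂ (evalSys f) x - fderiv ℂ (evalSys g) x := by
  have : evalSys (f - g) = fun x => evalSys f x - evalSys g x := funext (evalSys_sub f g)
  rw [this]
  exact fderiv_fun_sub (differentiable_evalSys f x) (differentiable_evalSys g x)

end Evaluation

/-! ### The maximum norm on systems. -/

section SupNorm

theorem bddAbove_norm_evalSys (f : HomSys n d) :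
    BddAbove (Set.range fun x : Metric.sphere (0 : Cvec n) 1 => ‖(evalSys f x).ofLp‖) := by
  have hc : Continuous fun x : Metric.sphere (0 : Cvec n) 1 => ‖(evalSys f x).ofLp‖ := by
    exact ((PiLp.continuous_ofLp 2 _).comp
      ((differentiable_evalSys f).continuous.comp continuous_subtype_val)).norm
  exact (isCompact_range hc).bddAbove

theorem supNorm_nonneg (f : HomSys n d) : 0 ≤ supNorm f :=
  Real.iSup_nonneg fun _ => norm_nonneg _

theorem norm_evalSys_apply_le (f : HomSys n d) (x : Cvec n) (i : Fin n) :
    ‖evalSys f x i‖ ≤ supNorm f * ‖x‖ ^ d i := by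
  have key : ∀ y : Cvec n, ‖y‖ = 1 → ‖evalSys f y i‖ ≤ supNorm f := fun y hy =>
    (norm_le_pi_norm (evalSys f y).ofLp i).trans
      (le_ciSup (bddAbove_norm_evalSys f) ⟨y, by simpa using hy⟩)
  rcases eq_or_ne x 0 with rfl | hx
  · have h := evalSys_smul_apply f 0 (0 : Cvec n) i
    rw [smul_zero] at h
    -- A component of degree 0 is constant, so its value at the origin is compared with that at a
    -- unit vector.
    rcases Nat.eq_zero_or_pos (d i) with h0 | h0
    · rw [h0, pow_zero, mul_one]
      obtain ⟨y, hy⟩ : ∃ y : Cvec n, ‖y‖ = 1 := ⟨EuclideanSpace.single 0 1, by simp⟩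
      have h1 := evalSys_smul_apply f 0 y i
      rw [zero_smul, h0, pow_zero, one_mul] at h1
      rw [h1]; exact key y hy
    · rw [h, zero_pow h0.ne', zero_mul, norm_zero]
      have := supNorm_nonneg f
      positivity
  · have hn : ‖x‖ ≠ 0 := norm_ne_zero_iff.mpr hx
    set y := ((‖x‖⁻¹ : ℝ) : ℂ) • x
    have hy : ‖y‖ = 1 := by
      rw [norm_smul, Complex.norm_real, norm_inv, norm_norm, inv_mul_cancel₀ hn]
    have hxy : x = (‖x‖ : ℂ) • y := by
      rw [smul_smul, ← Complex.ofReal_mul, mul_inv_cancel₀ hn, Complex.ofReal_one, one_smul]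
    calc ‖evalSys f x i‖ = ‖(‖x‖ : ℂ) ^ d i * evalSys f y i‖ := by
          rw [← evalSys_smul_apply, ← hxy]
      _ = ‖x‖ ^ d i * ‖evalSys f y i‖ := by
          rw [norm_mul, norm_pow, Complex.norm_real, norm_norm]
      _ ≤ ‖x‖ ^ d i * supNorm f := by gcongr; exact key y hy
      _ = _ := mul_comm _ _

theorem supNorm_le {f : HomSys n d} {C : ℝ} (hC : 0 ≤ C)
    (h : ∀ x : Cvec n, ‖x‖ = 1 → ∀ i, ‖evalSys f x i‖ ≤ C) : supNorm f ≤ C :=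
  Real.iSup_le (fun x => (pi_norm_le_iff_of_nonneg hC).mpr (h x (by simp))) hC

theorem norm_evalSys_apply_le_supNorm (f : HomSys n d) {x : Cvec n} (hx : ‖x‖ = 1) (i : Fin n) :
    ‖evalSys f x i‖ ≤ supNorm f := by
  simpa [hx] using norm_evalSys_apply_le f x i

theorem supNorm_add_le (f g : HomSys n d) : supNorm (f + g) ≤ supNorm f + supNorm g :=
  supNorm_le (add_nonneg (supNorm_nonneg f) (supNorm_nonneg g)) fun x hx i => by
    rw [evalSys_add]
    exact (norm_add_le _ _).trans
      (add_le_add (norm_evalSys_apply_le_supNorm f hx i) (norm_evalSys_apply_le_supNorm g hx i))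

theorem supNorm_smul_le (c : ℂ) (f : HomSys n d) : supNorm (c • f) ≤ ‖c‖ * supNorm f :=
  supNorm_le (mul_nonneg (norm_nonneg c) (supNorm_nonneg f)) fun x hx i => by
    rw [evalSys_smul]
    refine (norm_smul c _).le.trans ?_
    gcongr
    exact norm_evalSys_apply_le_supNorm f hx i

theorem supNorm_sub_comm (f g : HomSys n d) : supNorm (f - g) = supNorm (g - f) := by
  have h : ∀ f g : HomSys n d, supNorm (f - g) ≤ supNorm (g - f) := fun f g => by
    have := supNorm_smul_le (-1) (g - f)
    have e : (-1 : ℂ) • (g - f) = f - g := by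
      ext i : 2
      simp
    rwa [e, norm_neg, norm_one, one_mul] at this
  exact le_antisymm (h f g) (h g f)

theorem supNorm_le_add_sub (f g : HomSys n d) : supNorm f ≤ supNorm g + supNorm (f - g) := by
  have := supNorm_add_le g (f - g)
  rwa [add_sub_cancel] at this

end SupNorm

/-! ### Estimates for Δ⁻¹f and Δ⁻¹Df. -/

section ScaledDerivative

/-- The vector `Δ⁻¹ D_x f(v)`. -/
def scaledDeriv (f : HomSys n d) (x v : Cvec n) : EuclideanSpace ℂ (Fin n) :=
  WithLp.toLp 2 fun i => (d i : ℂ)⁻¹ * fderiv ℂ (evalSys f) x v i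

/-- The vector `Δ⁻¹ f(x)`. -/
def scaledEval (f : HomSys n d) (x : Cvec n) : EuclideanSpace ℂ (Fin n) :=
  WithLp.toLp 2 fun i => (d i : ℂ)⁻¹ * evalSys f x i

theorem norm_le_sqrt_mul {w : EuclideanSpace ℂ (Fin n)} {C : ℝ} (hC : 0 ≤ C)
    (h : ∀ i, ‖w i‖ ≤ C) : ‖w‖ ≤ √n * C := by
  rw [EuclideanSpace.norm_eq]
  refine Real.sqrt_le_iff.mpr ⟨by positivity, ?_⟩
  rw [mul_pow, Real.sq_sqrt (by positivity)]
  calc ∑ i, ‖w i‖ ^ 2 ≤ ∑ _i : Fin n, C ^ 2 := Finset.sum_le_sum fun i _ => by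
        gcongr; exact h i
    _ = n * C ^ 2 := by simp

theorem norm_le_norm_of_forall {v w : EuclideanSpace ℂ (Fin n)} {c : ℝ} (hc : 0 ≤ c)
    (h : ∀ i, ‖v i‖ ≤ c * ‖w i‖) : ‖v‖ ≤ c * ‖w‖ := by
  rw [EuclideanSpace.norm_eq, EuclideanSpace.norm_eq]
  refine Real.sqrt_le_iff.mpr ⟨by positivity, ?_⟩
  rw [mul_pow, Real.sq_sqrt (by positivity), Finset.mul_sum]
  refine Finset.sum_le_sum fun i _ => ?_
  rw [← mul_pow]
  gcongr
  exact h i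

theorem le_maxDeg (d : Fin n → ℕ) (i : Fin n) : d i ≤ maxDeg d :=
  Finset.le_sup (f := d) (Finset.mem_univ i)

theorem norm_inv_natCast_mul_le {k : ℕ} (hk : 1 ≤ k) {a : ℂ} {C : ℝ} (h : ‖a‖ ≤ k * C) :
    ‖(k : ℂ)⁻¹ * a‖ ≤ C := by
  have hk0 : (0 : ℝ) < k := by exact_mod_cast hk
  rw [norm_mul, norm_inv, Complex.norm_natCast, inv_mul_le_iff₀ hk0]
  exact h

theorem scaledDeriv_add_right (f : HomSys n d) (x v w : Cvec n) :
    scaledDeriv f x (v + w) = scaledDeriv f x v + scaledDeriv f x w := by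
  ext i; simp [scaledDeriv, mul_add]

theorem scaledDeriv_smul_right (f : HomSys n d) (x : Cvec n) (c : ℂ) (v : Cvec n) :
    scaledDeriv f x (c • v) = c • scaledDeriv f x v := by
  ext i; simp [scaledDeriv, mul_left_comm]

theorem scaledDeriv_sub_right (f : HomSys n d) (x v w : Cvec n) :
    scaledDeriv f x (v - w) = scaledDeriv f x v - scaledDeriv f x w := by
  ext i; simp [scaledDeriv, mul_sub]

theorem scaledDeriv_sub (f g : HomSys n d) (x v : Cvec n) :
    scaledDeriv (f - g) x v = scaledDeriv f x v - scaledDeriv g x v := by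
  ext i; simp [scaledDeriv, fderiv_evalSys_sub, mul_sub]

theorem scaledEval_sub (f g : HomSys n d) (x : Cvec n) :
    scaledEval (f - g) x = scaledEval f x - scaledEval g x := by
  ext i; simp [scaledEval, evalSys_sub, mul_sub]

theorem norm_scaledEval_le (f : HomSys n d) (hd : ∀ i, 1 ≤ d i) {x : Cvec n} (hx : ‖x‖ = 1) :
    ‖scaledEval f x‖ ≤ √n * supNorm f :=
  norm_le_sqrt_mul (supNorm_nonneg f) fun i => by
    refine norm_inv_natCast_mul_le (hd i) ((norm_evalSys_apply_le_supNorm f hx i).trans ?_)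
    have : (1 : ℝ) ≤ d i := by exact_mod_cast hd i
    nlinarith [supNorm_nonneg f]

/-- The factor d_i of the tangential Cauchy estimate cancels against Δ⁻¹, leaving a bound free of
the degrees. -/
theorem norm_scaledDeriv_le (f : HomSys n d) (hd : ∀ i, 1 ≤ d i) {x v : Cvec n} (hx : ‖x‖ = 1)
    (hv : inner ℂ x v = 0) : ‖scaledDeriv f x v‖ ≤ √n * supNorm f * ‖v‖ := by
  have h0 := supNorm_nonneg f
  rw [mul_assoc]
  refine norm_le_sqrt_mul (by positivity) fun i => ?_
  refine norm_inv_natCast_mul_le (hd i) ?_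
  rw [fderiv_evalSys_apply, ← mul_assoc]
  exact norm_fderiv_tangent_le ((contDiff_evalSys_apply f i).differentiable (by norm_num)) h0
    (hd i) (fun y => norm_evalSys_apply_le f y i) hx hv

/-- Of the two factors d_i in the Lipschitz estimate, Δ⁻¹ cancels one; the other is bounded by D. -/
theorem norm_scaledDeriv_sub_le (f : HomSys n d) (hd : ∀ i, 1 ≤ d i) {x h v : Cvec n}
    (hx : ‖x‖ = 1) (hh : inner ℂ x h = 0) (hv : inner ℂ x v = 0)
    (hsmall : maxDeg d * ‖h‖ ≤ 0.04) :
    ‖scaledDeriv f (x + h) v - scaledDeriv f x v‖ ≤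
      √n * (supNorm f * (1.6 * maxDeg d * ‖h‖) * ‖v‖) := by
  have h0 := supNorm_nonneg f
  refine norm_le_sqrt_mul (by positivity) fun i => ?_
  have hi : (scaledDeriv f (x + h) v - scaledDeriv f x v) i =
      (d i : ℂ)⁻¹ * (fderiv ℂ (fun y => evalSys f y i) (x + h) v -
        fderiv ℂ (fun y => evalSys f y i) x v) := by
    simp [scaledDeriv, fderiv_evalSys_apply, mul_sub]
  rw [hi]
  refine norm_inv_natCast_mul_le (hd i) ?_
  refine (norm_fderiv_sub_fderiv_le (contDiff_evalSys_apply f i) h0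
    (hd i) (fun y => norm_evalSys_apply_le f y i) hx hh hv ?_).trans ?_
  · refine le_trans ?_ hsmall
    gcongr
    exact le_maxDeg d i
  · calc 1.6 * (d i : ℝ) ^ 2 * supNorm f * ‖h‖ * ‖v‖
        = d i * (supNorm f * (1.6 * d i * ‖h‖) * ‖v‖) := by ring
      _ ≤ _ := by gcongr; exact le_maxDeg d i

theorem norm_scaledEval_taylor_le (f : HomSys n d) (hd : ∀ i, 1 ≤ d i) {x h : Cvec n}
    (hx : ‖x‖ = 1) (hh : inner ℂ x h = 0) (hsmall : maxDeg d * ‖h‖ ≤ 0.04) :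
    ‖scaledEval f (x + h) - scaledEval f x - scaledDeriv f x h‖ ≤
      √n * (supNorm f * (1.6 * maxDeg d * ‖h‖ ^ 2)) := by
  have h0 := supNorm_nonneg f
  refine norm_le_sqrt_mul (by positivity) fun i => ?_
  have hi : (scaledEval f (x + h) - scaledEval f x - scaledDeriv f x h) i =
      (d i : ℂ)⁻¹ * (evalSys f (x + h) i - evalSys f x i -
        fderiv ℂ (fun y => evalSys f y i) x h) := by
    simp [scaledDeriv, scaledEval, fderiv_evalSys_apply, mul_sub]
  rw [hi]
  refine norm_inv_natCast_mul_le (hd i) ?_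
  refine (norm_taylor_remainder_le (contDiff_evalSys_apply f i) h0
    (hd i) (fun y => norm_evalSys_apply_le f y i) hx hh ?_).trans ?_
  · refine le_trans ?_ hsmall
    gcongr
    exact le_maxDeg d i
  · calc 1.6 * (d i : ℝ) ^ 2 * supNorm f * ‖h‖ ^ 2
        = d i * (supNorm f * (1.6 * d i * ‖h‖ ^ 2)) := by ring
      _ ≤ _ := by gcongr; exact le_maxDeg d i

theorem scaledDeriv_smul_left_apply (f : HomSys n d) (hd : ∀ i, 1 ≤ d i) {c : ℂ} (hc : c ≠ 0)
    (x v : Cvec n) (i : Fin n) :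
    scaledDeriv f (c • x) v i = c ^ (d i - 1) * scaledDeriv f x v i := by
  simp only [scaledDeriv, fderiv_evalSys_smul_apply f hd hc]
  ring

theorem norm_scaledDeriv_smul_le (f : HomSys n d) (hd : ∀ i, 1 ≤ d i) {c : ℂ} (hc : c ≠ 0)
    (hc1 : ‖c‖ ≤ 1) (x v : Cvec n) : ‖scaledDeriv f (c • x) v‖ ≤ ‖scaledDeriv f x v‖ := by
  have := norm_le_norm_of_forall (v := scaledDeriv f (c • x) v) (w := scaledDeriv f x v)
    zero_le_one fun i => by
      rw [scaledDeriv_smul_left_apply f hd hc, norm_mul, norm_pow]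
      gcongr
      exact pow_le_one₀ (norm_nonneg c) hc1
  rwa [one_mul] at this

theorem norm_scaledDeriv_smul_le_pow (f : HomSys n d) (hd : ∀ i, 1 ≤ d i) {c : ℂ}
    (hc1 : 1 ≤ ‖c‖) (x v : Cvec n) :
    ‖scaledDeriv f (c • x) v‖ ≤ ‖c‖ ^ maxDeg d * ‖scaledDeriv f x v‖ := by
  have hc : c ≠ 0 := by rintro rfl; simp at hc1; linarith
  refine norm_le_norm_of_forall (by positivity) fun i => ?_
  rw [scaledDeriv_smul_left_apply f hd hc, norm_mul, norm_pow]
  gcongr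
  exact (Nat.sub_le _ _).trans (le_maxDeg d i)

theorem scaledDeriv_self_of_zero (f : HomSys n d) {x : Cvec n} (hx : evalSys f x = 0) :
    scaledDeriv f x x = 0 := by
  ext i; simp [scaledDeriv, fderiv_evalSys_self_apply, hx]

end ScaledDerivative

/-! ### Invertibility as a lower bound for the scaled derivative. -/

section Inverse

/-- The map `D_x f` on the tangent space at `x` is invertible and `‖(D_x f)⁻¹ Δ‖ ≤ κ`, expressed
as a lower bound for `Δ⁻¹ D_x f`. -/
def InvBound (f : HomSys n d) (x : Cvec n) (κ : ℝ) : Prop :=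
  ∀ v, inner ℂ x v = 0 → ‖v‖ ≤ κ * ‖scaledDeriv f x v‖

/-- The norm `‖(D_x f)⁻¹ Δ‖`. -/
def invNorm (f : HomSys n d) (x : Cvec n) : ℝ := ‖(tangentDeriv f x).inverse ∘L degDiag d‖

theorem invNorm_nonneg (f : HomSys n d) (x : Cvec n) : 0 ≤ invNorm f x := by
  unfold invNorm; positivity

theorem degDiag_apply (w : EuclideanSpace ℂ (Fin n)) (i : Fin n) :
    degDiag d w i = d i * w i := by
  simp [degDiag, Matrix.mulVec_diagonal]

theorem degDiag_scaledDeriv (f : HomSys n d) (hd : ∀ i, 1 ≤ d i) (x v : Cvec n) :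
    degDiag d (scaledDeriv f x v) = fderiv ℂ (evalSys f) x v := by
  ext i
  have : (d i : ℂ) ≠ 0 := by have := hd i; exact_mod_cast (by omega : d i ≠ 0)
  rw [degDiag_apply]
  simp [scaledDeriv, this]

theorem degDiag_scaledEval (f : HomSys n d) (hd : ∀ i, 1 ≤ d i) (x : Cvec n) :
    degDiag d (scaledEval f x) = evalSys f x := by
  ext i
  have : (d i : ℂ) ≠ 0 := by have := hd i; exact_mod_cast (by omega : d i ≠ 0)
  rw [degDiag_apply]
  simp [scaledEval, this]

theorem degDiag_injective (hd : ∀ i, 1 ≤ d i) {w w' : EuclideanSpace ℂ (Fin n)}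
    (h : degDiag d w = degDiag d w') : w = w' := by
  ext i
  have h0 : (d i : ℂ) ≠ 0 := by have := hd i; exact_mod_cast (by omega : d i ≠ 0)
  have := congrArg (fun w => w i) h
  simp only [degDiag_apply] at this
  exact mul_left_cancel₀ h0 this

theorem mem_tangent {x v : Cvec n} : v ∈ Tangent x ↔ inner ℂ x v = 0 :=
  Submodule.mem_orthogonal_singleton_iff_inner_right

theorem invBound_invNorm {f : HomSys n d} (hd : ∀ i, 1 ≤ d i) {x : Cvec n}
    (h : (tangentDeriv f x).IsInvertible) : InvBound f x (invNorm f x) := by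
  intro v hv
  set v' : Tangent x := ⟨v, mem_tangent.mpr hv⟩
  have h1 : ((tangentDeriv f x).inverse ∘L degDiag d) (scaledDeriv f x v) = v' := by
    rw [ContinuousLinearMap.comp_apply, degDiag_scaledDeriv f hd]
    exact h.inverse_apply_eq.mpr rfl
  calc ‖v‖ = ‖((tangentDeriv f x).inverse ∘L degDiag d) (scaledDeriv f x v)‖ := by rw [h1]; rfl
    _ ≤ _ := ContinuousLinearMap.le_opNorm _ _

theorem finrank_tangent {x : Cvec n} (hx : x ≠ 0) : Module.finrank ℂ (Tangent x) = n := by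
  have : Fact (Module.finrank ℂ (Cvec n) = n + 1) := ⟨by simp⟩
  exact Submodule.finrank_orthogonal_span_singleton hx

/-- The lower bound makes the kernel trivial, and source and target both have dimension n. -/
theorem InvBound.isInvertible {f : HomSys n d} {x : Cvec n} (hx : x ≠ 0) {κ : ℝ}
    (h : InvBound f x κ) : (tangentDeriv f x).IsInvertible := by
  have hinj : Function.Injective (tangentDeriv f x).toLinearMap := by
    rw [injective_iff_map_eq_zero]
    intro v hv
    have hv0 : fderiv ℂ (evalSys f) x v = 0 := hv
    have h1 := h v (mem_tangent.mp v.2)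
    have h2 : scaledDeriv f x v = 0 := by ext i; simp [scaledDeriv, hv0]
    rw [h2, norm_zero, mul_zero] at h1
    exact Subtype.ext (norm_le_zero_iff.mp h1)
  have hfr : Module.finrank ℂ (Tangent x) = Module.finrank ℂ (EuclideanSpace ℂ (Fin n)) := by
    rw [finrank_tangent hx, finrank_euclideanSpace_fin]
  exact ⟨(LinearEquiv.ofInjectiveOfFinrankEq _ hinj hfr).toContinuousLinearEquiv, by ext; rfl⟩

theorem InvBound.invNorm_le {f : HomSys n d} (hd : ∀ i, 1 ≤ d i) {x : Cvec n} (hx : x ≠ 0) {κ : ℝ}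
    (hκ : 0 ≤ κ) (h : InvBound f x κ) : invNorm f x ≤ κ := by
  refine ContinuousLinearMap.opNorm_le_bound _ hκ fun w => ?_
  set v : Tangent x := (tangentDeriv f x).inverse (degDiag d w) with hv
  have h1 : tangentDeriv f x v = degDiag d w :=
    ((h.isInvertible hx).inverse_apply_eq.mp hv.symm).symm
  have h2 : scaledDeriv f x v = w := degDiag_injective hd (by rw [degDiag_scaledDeriv f hd]; exact h1)
  have := h v (mem_tangent.mp v.2)
  rw [h2] at this
  exact this

theorem InvBound.mono {f : HomSys n d} {x : Cvec n} {κ κ' : ℝ} (h : InvBound f x κ)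
    (hκ : κ ≤ κ') : InvBound f x κ' := fun v hv => (h v hv).trans (by gcongr)

/-- Compare the lower and the upper bound for Δ⁻¹Df on one nonzero tangent vector, which exists
because n ≥ 1. This is the source of M ≥ 1. -/
theorem InvBound.one_le (hn : 1 ≤ n) {f : HomSys n d} (hd : ∀ i, 1 ≤ d i) {x : Cvec n}
    (hx : ‖x‖ = 1) {κ : ℝ} (hκ : 0 ≤ κ) (h : InvBound f x κ) : 1 ≤ κ * (√n * supNorm f) := by
  have hx0 : x ≠ 0 := by rintro rfl; simp at hx
  have : Nontrivial (Tangent x) := 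
    Module.nontrivial_of_finrank_pos (R := ℂ) (by rw [finrank_tangent hx0]; omega)
  obtain ⟨v, hv⟩ := exists_ne (0 : Tangent x)
  have hv' := mem_tangent.mp v.2
  have h1 := h v hv'
  have h2 := norm_scaledDeriv_le f hd hx hv'
  have hpos : 0 < ‖(v : Cvec n)‖ := norm_pos_iff.mpr (by simpa using hv)
  have h3 : ‖(v : Cvec n)‖ ≤ κ * (√n * supNorm f * ‖(v : Cvec n)‖) := h1.trans (by gcongr)
  by_contra! hlt
  nlinarith

end Inverse

/-! ### The affine chart x + x^⊥ of projective space. -/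

section Chart

variable {E : Type*} [NormedAddCommGroup E] [InnerProductSpace ℂ E]

/-- The point of `x + x^⊥` on the line spanned by `y`, minus `x`. -/
def chartVec (x y : E) : E := (inner ℂ x y : ℂ)⁻¹ • y - x

theorem add_chartVec (x y : E) : x + chartVec x y = (inner ℂ x y : ℂ)⁻¹ • y := by
  simp [chartVec]

theorem inner_chartVec {x y : E} (hx : ‖x‖ = 1) (hxy : (inner ℂ x y : ℂ) ≠ 0) :
    inner ℂ x (chartVec x y) = 0 := by
  rw [chartVec, inner_sub_right, inner_smul_right, inv_mul_cancel₀ hxy, inner_self_eq_norm_sq_to_K,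
    hx]
  simp

theorem norm_inv_inner_sq {x y : E} (hx : ‖x‖ = 1) (hy : ‖y‖ = 1) (hxy : (inner ℂ x y : ℂ) ≠ 0) :
    ‖(inner ℂ x y : ℂ)⁻¹‖ ^ 2 = 1 + ‖chartVec x y‖ ^ 2 := by
  have h1 := norm_add_orthogonal hx (inner_chartVec hx hxy)
  rw [add_chartVec, norm_smul, hy, mul_one] at h1
  rw [h1, Real.sq_sqrt (by positivity)]

theorem norm_inner_sq_mul {x y : E} (hx : ‖x‖ = 1) (hy : ‖y‖ = 1) (hxy : (inner ℂ x y : ℂ) ≠ 0) :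
    ‖(inner ℂ x y : ℂ)‖ ^ 2 * (1 + ‖chartVec x y‖ ^ 2) = 1 := by
  rw [← norm_inv_inner_sq hx hy hxy, ← mul_pow, ← norm_mul, mul_inv_cancel₀ hxy]
  simp

/-- The sine of the angle is the distance from y to the line ℂx, hence at most the distance to any
of its points. -/
theorem one_sub_norm_inner_sq_le {x y : E} (hx : ‖x‖ = 1) (hy : ‖y‖ = 1) (c : ℂ) :
    1 - ‖(inner ℂ x y : ℂ)‖ ^ 2 ≤ ‖y - c • x‖ ^ 2 := by
  have h0 : (inner ℂ x (y - (inner ℂ x y : ℂ) • x) : ℂ) = 0 := by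
    rw [inner_sub_right, inner_smul_right, inner_self_eq_norm_sq_to_K, hx]
    simp
  have h1 : ∀ e : ℂ, ‖e • x + (y - (inner ℂ x y : ℂ) • x)‖ ^ 2 =
      ‖e‖ ^ 2 + ‖y - (inner ℂ x y : ℂ) • x‖ ^ 2 := fun e => by
    have := norm_add_sq_eq_norm_sq_add_norm_sq_of_inner_eq_zero (𝕜 := ℂ) (e • x)
      (y - (inner ℂ x y : ℂ) • x) (by rw [inner_smul_left, h0, mul_zero])
    rw [norm_smul e, hx, mul_one] at this
    linarith
  have h2 := h1 (inner ℂ x y)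
  have h3 := h1 ((inner ℂ x y : ℂ) - c)
  rw [add_sub_cancel, hy] at h2
  have h4 : ((inner ℂ x y : ℂ) - c) • x + (y - (inner ℂ x y : ℂ) • x) = y - c • x := by
    rw [sub_smul]; abel
  rw [h4] at h3
  nlinarith [sq_nonneg ‖(inner ℂ x y : ℂ) - c‖]

/-- Normalising v divides distances by ‖c‖ ≥ 1. This allows the unnormalised Newton vector u to be
compared with the chart point v. -/
theorem one_sub_norm_inner_sq_le_of_smul {x y u v : E} (hx : ‖x‖ = 1) (hy : ‖y‖ = 1) {a c : ℂ}
    (ha : x = a • u) (hc1 : 1 ≤ ‖c‖) (hc : v = c • y) :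
    1 - ‖(inner ℂ x y : ℂ)‖ ^ 2 ≤ ‖v - u‖ ^ 2 := by
  have hc0 : c ≠ 0 := by rintro rfl; simp at hc1; linarith
  have ha0 : a ≠ 0 := by rintro rfl; simp [ha] at hx
  refine (one_sub_norm_inner_sq_le hx hy (c⁻¹ * a⁻¹)).trans ?_
  have : y - (c⁻¹ * a⁻¹) • x = c⁻¹ • (v - u) := by
    rw [ha, hc, smul_sub, smul_smul, smul_smul, mul_assoc, inv_mul_cancel₀ ha0, mul_one,
      inv_mul_cancel₀ hc0, one_smul]
  rw [this, norm_smul, norm_inv]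
  gcongr
  calc ‖c‖⁻¹ * ‖v - u‖ ≤ 1 * ‖v - u‖ := by gcongr; exact inv_le_one_of_one_le₀ hc1
    _ = _ := one_mul _

/-- The hypothesis bounds the sine of the angle and the chart vector has the tangent as norm; at
small angles the two nearly agree. -/
theorem norm_chartVec_le {x y : E} (hx : ‖x‖ = 1) (hy : ‖y‖ = 1) {e : ℝ} (he0 : 0 ≤ e)
    (he : e ≤ 0.03) (h : 1 - ‖(inner ℂ x y : ℂ)‖ ^ 2 ≤ e ^ 2) :
    (inner ℂ x y : ℂ) ≠ 0 ∧ ‖chartVec x y‖ ≤ 1.001 * e := by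
  have hxy : (inner ℂ x y : ℂ) ≠ 0 := by
    intro h0
    rw [h0, norm_zero] at h
    nlinarith
  refine ⟨hxy, ?_⟩
  have h1 := norm_inner_sq_mul hx hy hxy
  set t := ‖chartVec x y‖
  set c := ‖(inner ℂ x y : ℂ)‖
  refine (sq_le_sq₀ (norm_nonneg _) (by positivity)).mp ?_
  have h2 : c ^ 2 * t ^ 2 ≤ e ^ 2 := by nlinarith
  have h3 : 1 - 0.0009 ≤ c ^ 2 := by nlinarith
  nlinarith [sq_nonneg t]

end Chart

/-- Bernoulli gives (1 - a²)^k ≥ 1 - ka², and (1 + a²)(1 - a²) ≤ 1. -/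
theorem one_add_sq_pow_le {k : ℕ} {a : ℝ} (ha : 0 ≤ a) (h : k * a ≤ 0.04) :
    √(1 + a ^ 2) ^ k ≤ 1.001 := by
  refine sqrt_pow_le_of_pow_le k (by positivity) (by norm_num) ?_
  rcases Nat.eq_zero_or_pos k with rfl | hk
  · norm_num
  have hk1 : (1 : ℝ) ≤ k := by exact_mod_cast hk
  have ha1 : a ≤ 0.04 := by nlinarith
  have h1 : 1 + k * (-a ^ 2) ≤ (1 + -a ^ 2) ^ k := one_add_mul_le_pow (by nlinarith) k
  have h2 : (1 + a ^ 2) ^ k * (1 + -a ^ 2) ^ k ≤ 1 := by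
    rw [← mul_pow]
    exact pow_le_one₀ (mul_nonneg (by positivity) (by nlinarith)) (by nlinarith [sq_nonneg (a ^ 2)])
  have h3 : k * a ^ 2 ≤ 0.0016 := by nlinarith
  have h4 : 0 ≤ (1 + a ^ 2) ^ k := by positivity
  nlinarith

/-- `x` is a unit vector and `x + h`, with `h` tangent at `x`, represents the zero `y` of `g`. -/
structure ZeroChart (g : HomSys n d) (x h y : Cvec n) (c : ℂ) : Prop where
  norm_left : ‖x‖ = 1
  norm_right : ‖y‖ = 1
  orth : inner ℂ x h = 0
  add_eq : x + h = c • y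
  zero : evalSys g y = 0

/-! ### Moving between a point x and a nearby zero y. -/

namespace ZeroChart

variable {f g : HomSys n d} {x h y : Cvec n} {c : ℂ}

theorem norm_eq (H : ZeroChart g x h y c) : ‖c‖ = √(1 + ‖h‖ ^ 2) := by
  rw [← norm_add_orthogonal H.norm_left H.orth, H.add_eq, norm_smul, H.norm_right, mul_one]

theorem one_le_norm (H : ZeroChart g x h y c) : 1 ≤ ‖c‖ := by
  rw [H.norm_eq]
  exact Real.one_le_sqrt.mpr (by nlinarith [sq_nonneg ‖h‖])

theorem ne_zero (H : ZeroChart g x h y c) : c ≠ 0 := by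
  have := H.one_le_norm
  rintro rfl
  simp at this
  linarith

theorem left_ne_zero (H : ZeroChart g x h y c) : x ≠ 0 := by
  have := H.norm_left
  rintro rfl
  simp at this

theorem right_ne_zero (H : ZeroChart g x h y c) : y ≠ 0 := by
  have := H.norm_right
  rintro rfl
  simp at this

theorem norm_pow_le (H : ZeroChart g x h y c) (hsmall : maxDeg d * ‖h‖ ≤ 0.04) :
    ‖c‖ ^ maxDeg d ≤ 1.001 := by
  rw [H.norm_eq]
  exact one_add_sq_pow_le (norm_nonneg h) hsmall

theorem norm_le (H : ZeroChart g x h y c) (hD : 1 ≤ maxDeg d) (hsmall : maxDeg d * ‖h‖ ≤ 0.04) :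
    ‖c‖ ≤ 1.001 :=
  (le_self_pow₀ H.one_le_norm (by omega)).trans (H.norm_pow_le hsmall)

theorem scaledEval_eq_zero (H : ZeroChart g x h y c) : scaledEval g (x + h) = 0 := by
  ext i
  have : evalSys g y i = 0 := by rw [H.zero]; rfl
  simp [scaledEval, H.add_eq, evalSys_smul_apply, this]

theorem norm_scaledDeriv_sub_le (H : ZeroChart g x h y c) (hd : ∀ i, 1 ≤ d i)
    (hsmall : maxDeg d * ‖h‖ ≤ 0.04) {v : Cvec n} (hv : inner ℂ x v = 0) :
    ‖scaledDeriv g (x + h) v - scaledDeriv f x v‖ ≤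
      √n * (supNorm (g - f) + supNorm g * (1.6 * maxDeg d * ‖h‖)) * ‖v‖ := by
  have h1 := LinearHomotopy.norm_scaledDeriv_sub_le g hd H.norm_left H.orth hv hsmall
  have h2 := norm_scaledDeriv_le (g - f) hd H.norm_left hv
  rw [scaledDeriv_sub] at h2
  calc ‖scaledDeriv g (x + h) v - scaledDeriv f x v‖
      = ‖(scaledDeriv g (x + h) v - scaledDeriv g x v) +
          (scaledDeriv g x v - scaledDeriv f x v)‖ := by congr 1; abel
    _ ≤ _ := norm_add_le _ _
    _ ≤ √n * (supNorm g * (1.6 * maxDeg d * ‖h‖) * ‖v‖) + √n * supNorm (g - f) * ‖v‖ := by gcongr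
    _ = _ := by ring

/-- Passing from `f` at `x` to the zero `y` of the neighbouring system `g`. -/
theorem invBound_right (H : ZeroChart g x h y c) (hd : ∀ i, 1 ≤ d i)
    (hsmall : maxDeg d * ‖h‖ ≤ 0.04) {κ e : ℝ} (hκ : 0 ≤ κ) (hf : InvBound f x κ)
    (he : κ * (√n * (supNorm (g - f) + supNorm g * (1.6 * maxDeg d * ‖h‖))) ≤ e) (he1 : e < 1) :
    InvBound g y (1.001 * κ / (1 - e)) := by
  intro w hw
  -- Shifting w along y reaches x^⊥. It cannot shorten w, as w ⟂ y, and it leaves the image under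
  -- D_y g unchanged by Euler's identity.
  set v := w - (inner ℂ x w : ℂ) • (x + h) with hv
  have hxv : inner ℂ x v = 0 := by
    rw [hv, inner_sub_right, inner_smul_right, inner_add_right, H.orth,
      inner_self_eq_norm_sq_to_K, H.norm_left]
    simp
  have hwv : ‖w‖ ≤ ‖v‖ := by
    have h1 : (inner ℂ w (-((inner ℂ x w : ℂ) • (x + h))) : ℂ) = 0 := by
      rw [inner_neg_right, H.add_eq, inner_smul_right, inner_smul_right,
        inner_eq_zero_symm.mp hw]
      simp
    have h2 := norm_add_sq_eq_norm_sq_add_norm_sq_of_inner_eq_zero (𝕜 := ℂ) _ _ h1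
    rw [← sub_eq_add_neg, ← hv] at h2
    nlinarith [norm_nonneg v, norm_nonneg w, norm_nonneg (-((inner ℂ x w : ℂ) • (x + h)))]
  have hDv : scaledDeriv g y v = scaledDeriv g y w := by
    rw [hv, scaledDeriv_sub_right, H.add_eq, scaledDeriv_smul_right, scaledDeriv_smul_right,
      scaledDeriv_self_of_zero g H.zero]
    simp
  have h1 := hf v hxv
  have h2 := H.norm_scaledDeriv_sub_le (f := f) hd hsmall hxv
  have h3 : ‖scaledDeriv g (x + h) v‖ ≤ 1.001 * ‖scaledDeriv g y w‖ := by
    rw [H.add_eq, ← hDv]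
    refine (norm_scaledDeriv_smul_le_pow g hd H.one_le_norm y v).trans ?_
    gcongr
    exact H.norm_pow_le hsmall
  have h4 : ‖scaledDeriv f x v‖ ≤ ‖scaledDeriv g (x + h) v‖ +
      ‖scaledDeriv g (x + h) v - scaledDeriv f x v‖ := by
    have := norm_sub_le (scaledDeriv g (x + h) v) (scaledDeriv g (x + h) v - scaledDeriv f x v)
    rwa [sub_sub_cancel] at this
  set A := √n * (supNorm (g - f) + supNorm g * (1.6 * maxDeg d * ‖h‖))
  have h5 : ‖v‖ ≤ κ * (1.001 * ‖scaledDeriv g y w‖ + A * ‖v‖) :=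
    h1.trans (by gcongr; linarith)
  have h6 : κ * A * ‖v‖ ≤ e * ‖v‖ := by gcongr
  refine hwv.trans ?_
  rw [div_mul_eq_mul_div, le_div_iff₀ (by linarith)]
  linarith

/-- Passing from the zero `y` of `g` to the neighbouring system `f` at `x`. -/
theorem norm_le_of_invBound_right (H : ZeroChart g x h y c) (hd : ∀ i, 1 ≤ d i)
    (hsmall : maxDeg d * ‖h‖ ≤ 0.04) {κ : ℝ} (hκ : 0 ≤ κ) (hg : InvBound g y κ) {v : Cvec n}
    (hv : inner ℂ x v = 0) :
    ‖v‖ ≤ ‖c‖ * κ * (‖scaledDeriv f x v‖ +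
      √n * (supNorm (g - f) + supNorm g * (1.6 * maxDeg d * ‖h‖)) * ‖v‖) := by
  -- The projection to y^⊥ also keeps the image under D_y g. It shortens v at most by the factor
  -- ‖c‖, because ⟨cy, v⟩ = ⟨h, v⟩.
  set w := v - (inner ℂ y v : ℂ) • y with hw
  have hyw : inner ℂ y w = 0 := by
    rw [hw, inner_sub_right, inner_smul_right, inner_self_eq_norm_sq_to_K, H.norm_right]
    simp
  have hvw : ‖v‖ ≤ ‖c‖ * ‖w‖ := by
    have h1 : (inner ℂ w ((inner ℂ y v : ℂ) • y) : ℂ) = 0 := by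
      rw [inner_smul_right, inner_eq_zero_symm.mp hyw]
      simp
    have h2 := norm_add_sq_eq_norm_sq_add_norm_sq_of_inner_eq_zero (𝕜 := ℂ) _ _ h1
    rw [hw, sub_add_cancel, ← hw, norm_smul, H.norm_right, mul_one] at h2
    have h3 : ‖c‖ * ‖(inner ℂ y v : ℂ)‖ ≤ ‖h‖ * ‖v‖ := by
      have : (inner ℂ (c • y) v : ℂ) = inner ℂ h v := by
        rw [← H.add_eq, inner_add_left, hv, zero_add]
      calc ‖c‖ * ‖(inner ℂ y v : ℂ)‖ = ‖(inner ℂ (c • y) v : ℂ)‖ := by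
            rw [inner_smul_left, norm_mul, RCLike.norm_conj]
        _ ≤ _ := by rw [this]; exact norm_inner_le_norm _ _
    have h4 : ‖c‖ ^ 2 = 1 + ‖h‖ ^ 2 := by rw [H.norm_eq, Real.sq_sqrt (by positivity)]
    have h5 := mul_self_le_mul_self (by positivity) h3
    refine (sq_le_sq₀ (norm_nonneg v) (by positivity)).mp ?_
    rw [mul_pow]
    nlinarith
  have hDw : scaledDeriv g y w = scaledDeriv g y v := by
    rw [hw, scaledDeriv_sub_right, scaledDeriv_smul_right, scaledDeriv_self_of_zero g H.zero]
    simp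
  have h1 := hg w hyw
  have h2 := H.norm_scaledDeriv_sub_le (f := f) hd hsmall hv
  have h3 : ‖scaledDeriv g y v‖ ≤ ‖scaledDeriv g (x + h) v‖ := by
    have := norm_scaledDeriv_smul_le g hd (inv_ne_zero H.ne_zero)
      (by rw [norm_inv]; exact inv_le_one_of_one_le₀ H.one_le_norm) (x + h) v
    rwa [H.add_eq, inv_smul_smul₀ H.ne_zero, ← H.add_eq] at this
  have h4 : ‖scaledDeriv g (x + h) v‖ ≤ ‖scaledDeriv f x v‖ +
      ‖scaledDeriv g (x + h) v - scaledDeriv f x v‖ := by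
    have := norm_add_le (scaledDeriv f x v) (scaledDeriv g (x + h) v - scaledDeriv f x v)
    rwa [add_sub_cancel] at this
  rw [hDw] at h1
  calc ‖v‖ ≤ ‖c‖ * ‖w‖ := hvw
    _ ≤ ‖c‖ * (κ * (‖scaledDeriv f x v‖ +
      √n * (supNorm (g - f) + supNorm g * (1.6 * maxDeg d * ‖h‖)) * ‖v‖)) := by
        gcongr
        refine h1.trans ?_
        gcongr
        linarith
    _ = _ := by ring

theorem invBound_left (H : ZeroChart g x h y c) (hd : ∀ i, 1 ≤ d i) (hD : 1 ≤ maxDeg d)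
    (hsmall : maxDeg d * ‖h‖ ≤ 0.04) {κ e : ℝ} (hκ : 0 ≤ κ) (hg : InvBound g y κ)
    (he : 1.001 * κ * (√n * (supNorm (g - f) + supNorm g * (1.6 * maxDeg d * ‖h‖))) ≤ e)
    (he1 : e < 1) : InvBound f x (1.001 * κ / (1 - e)) := by
  intro v hv
  have h1 := H.norm_le_of_invBound_right (f := f) hd hsmall hκ hg hv
  have h2 := H.norm_le hD hsmall
  have h0 := supNorm_nonneg g
  have h0' := supNorm_nonneg (g - f)
  set A := √n * (supNorm (g - f) + supNorm g * (1.6 * maxDeg d * ‖h‖)) with hA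
  have hA0 : 0 ≤ A := by positivity
  have h3 : ‖v‖ ≤ 1.001 * κ * (‖scaledDeriv f x v‖ + A * ‖v‖) := h1.trans (by gcongr)
  have h4 : 1.001 * κ * A * ‖v‖ ≤ e * ‖v‖ := by gcongr
  rw [div_mul_eq_mul_div, le_div_iff₀ (by linarith)]
  linarith

/-- Smallness is measured with the unknown norm ν itself, which yields 1 + e rather than 1/(1 - e).
If 1.001κA < 1, rearrange ν ≤ 1.001κ/(1 - 1.001κA); otherwise ν ≤ 1.001κAν ≤ 1.001κe. -/
theorem invNorm_left_le (H : ZeroChart g x h y c) (hd : ∀ i, 1 ≤ d i) (hD : 1 ≤ maxDeg d)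
    (hsmall : maxDeg d * ‖h‖ ≤ 0.04) {κ e : ℝ} (hκ : 0 ≤ κ) (hg : InvBound g y κ)
    (he : invNorm f x * (√n * (supNorm (g - f) + supNorm g * (1.6 * maxDeg d * ‖h‖))) ≤ e) :
    invNorm f x ≤ 1.001 * κ * (1 + e) := by
  set A := √n * (supNorm (g - f) + supNorm g * (1.6 * maxDeg d * ‖h‖)) with hA
  have hν := invNorm_nonneg f x
  rcases lt_or_ge (1.001 * κ * A) 1 with hlt | hge
  · have h1 := (H.invBound_left (f := f) (e := 1.001 * κ * A) hd hD hsmall hκ hg le_rfl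
      hlt).invNorm_le hd H.left_ne_zero (div_nonneg (by positivity) (by linarith))
    rw [le_div_iff₀ (by linarith)] at h1
    nlinarith
  · nlinarith

/-- Since g(x + h) = 0, the derivative D_x g maps the Newton error to minus the Taylor remainder at
x. -/
theorem norm_add_sub_newtonVec_le (H : ZeroChart g x h y c) (hd : ∀ i, 1 ≤ d i)
    (hsmall : maxDeg d * ‖h‖ ≤ 0.04) {κ : ℝ} (hκ : 0 ≤ κ) (hg : InvBound g x κ) :
    ‖x + h - newtonVec g x‖ ≤ κ * (√n * (supNorm g * (1.6 * maxDeg d * ‖h‖ ^ 2))) := by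
  set s : Tangent x := (tangentDeriv g x).inverse (evalSys g x) with hs
  have h1 : tangentDeriv g x s = evalSys g x :=
    (((hg.isInvertible H.left_ne_zero).inverse_apply_eq).mp hs.symm).symm
  have h2 : scaledDeriv g x s = scaledEval g x :=
    degDiag_injective hd (by rw [degDiag_scaledDeriv g hd, degDiag_scaledEval g hd]; exact h1)
  have hsx := mem_tangent.mp s.2
  have h3 : x + h - newtonVec g x = h + s := by rw [newtonVec, ← hs]; abel
  rw [h3]
  refine (hg (h + s) (by rw [inner_add_right, H.orth, hsx, add_zero])).trans ?_
  gcongr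
  have h4 := norm_scaledEval_taylor_le g hd H.norm_left H.orth hsmall
  rw [H.scaledEval_eq_zero] at h4
  rw [scaledDeriv_add_right, h2, ← norm_neg]
  have h5 : -(scaledDeriv g x h + scaledEval g x) =
      0 - scaledEval g x - scaledDeriv g x h := by abel
  rwa [h5]

/-- Subtract the expansions of f at x + h₀ and g at x + h, both zero: what remains are two quadratic
remainders and the value and derivative of g - f at x. -/
theorem norm_sub_le {h₀ y₀ : Cvec n} {c₀ : ℂ} (H₀ : ZeroChart f x h₀ y₀ c₀)
    (H : ZeroChart g x h y c) (hd : ∀ i, 1 ≤ d i) (hsmall₀ : maxDeg d * ‖h₀‖ ≤ 0.04)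
    (hsmall : maxDeg d * ‖h‖ ≤ 0.04) {κ : ℝ} (hκ : 0 ≤ κ) (hf : InvBound f x κ) :
    ‖h - h₀‖ ≤ κ * (√n * (supNorm (g - f) + supNorm g * (1.6 * maxDeg d * ‖h‖ ^ 2) +
      supNorm f * (1.6 * maxDeg d * ‖h₀‖ ^ 2) + supNorm (g - f) * ‖h‖)) := by
  refine (hf (h - h₀) (by rw [inner_sub_right, H.orth, H₀.orth, sub_zero])).trans ?_
  gcongr
  have h1 := norm_scaledEval_taylor_le g hd H.norm_left H.orth hsmall
  have h2 := norm_scaledEval_taylor_le f hd H₀.norm_left H₀.orth hsmall₀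
  have h3 := norm_scaledEval_le (g - f) hd H.norm_left
  have h4 := norm_scaledDeriv_le (g - f) hd H.norm_left H.orth
  rw [H.scaledEval_eq_zero] at h1
  rw [H₀.scaledEval_eq_zero] at h2
  rw [scaledEval_sub] at h3
  rw [scaledDeriv_sub] at h4
  have h5 : scaledDeriv f x (h - h₀) = (0 - scaledEval f x - scaledDeriv f x h₀) -
      (0 - scaledEval g x - scaledDeriv g x h) - (scaledEval g x - scaledEval f x) -
      (scaledDeriv g x h - scaledDeriv f x h) := by
    rw [scaledDeriv_sub_right]; abel
  rw [h5]
  refine (_root_.norm_sub_le _ _).trans ?_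
  have h6 := _root_.norm_sub_le ((0 - scaledEval f x - scaledDeriv f x h₀) -
      (0 - scaledEval g x - scaledDeriv g x h)) (scaledEval g x - scaledEval f x)
  have h7 := _root_.norm_sub_le (0 - scaledEval f x - scaledDeriv f x h₀)
      (0 - scaledEval g x - scaledDeriv g x h)
  linarith

end ZeroChart

theorem zeroChart_chartVec {g : HomSys n d} {x y : Cvec n} (hx : ‖x‖ = 1) (hy : ‖y‖ = 1)
    (hxy : (inner ℂ x y : ℂ) ≠ 0) (hz : evalSys g y = 0) :
    ZeroChart g x (chartVec x y) y (inner ℂ x y : ℂ)⁻¹ :=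
  ⟨hx, hy, inner_chartVec hx hxy, add_chartVec x y, hz⟩

theorem InvBound.perturb {f g : HomSys n d} (hd : ∀ i, 1 ≤ d i) {x : Cvec n} (hx : ‖x‖ = 1)
    {κ e : ℝ} (hκ : 0 ≤ κ) (hf : InvBound f x κ) (he : κ * (√n * supNorm (g - f)) ≤ e)
    (he1 : e < 1) : InvBound g x (κ / (1 - e)) := by
  intro v hv
  have h1 := hf v hv
  have h2 := norm_scaledDeriv_le (g - f) hd hx hv
  have h3 := norm_sub_le (scaledDeriv g x v) (scaledDeriv (g - f) x v)
  rw [scaledDeriv_sub] at h2 h3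
  rw [sub_sub_cancel] at h3
  have h4 : ‖v‖ ≤ κ * (‖scaledDeriv g x v‖ + √n * supNorm (g - f) * ‖v‖) :=
    h1.trans (by gcongr; linarith)
  have h5 : κ * (√n * supNorm (g - f)) * ‖v‖ ≤ e * ‖v‖ := by gcongr
  rw [div_mul_eq_mul_div, le_div_iff₀ (by linarith)]
  linarith

/-- The real number `√n ‖f‖_∞ ‖(D_x f)⁻¹ Δ‖`. -/
def condReal (f : HomSys n d) (x : Cvec n) : ℝ := √n * supNorm f * invNorm f x

theorem one_le_condReal (hn : 1 ≤ n) {f : HomSys n d} (hd : ∀ i, 1 ≤ d i) {x : Cvec n}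
    (hx : ‖x‖ = 1) (h : (tangentDeriv f x).IsInvertible) : 1 ≤ condReal f x := by
  have := (invBound_invNorm hd h).one_le hn hd hx (invNorm_nonneg f x)
  rwa [mul_comm] at this

theorem one_le_maxDeg (hn : 1 ≤ n) (hd : ∀ i, 1 ≤ d i) : 1 ≤ maxDeg d :=
  (hd ⟨0, hn⟩).trans (le_maxDeg d ⟨0, hn⟩)

theorem supNorm_sub_self (f : HomSys n d) : supNorm (f - f) = 0 :=
  le_antisymm (supNorm_le le_rfl fun x _ i => by rw [evalSys_sub, sub_self]; simp) (supNorm_nonneg _)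

/-- The data of a step of the path-following method: `g` is close to `f` relative to the condition
of `f` at `x`. -/
structure StepData (f g : HomSys n d) (x : Cvec n) : Prop where
  one_le_card : 1 ≤ n
  one_le_deg : ∀ i, 1 ≤ d i
  norm_eq_one : ‖x‖ = 1
  isInvertible : (tangentDeriv f x).IsInvertible
  close : maxDeg d * condReal f x ^ 2 * supNorm (g - f) ≤ 0.03 * supNorm f

/-! ### One step: perturbation, confinement and the Newton correction. -/

namespace StepData

variable {f g : HomSys n d} {x : Cvec n}

theorem one_le_cond (S : StepData f g x) : 1 ≤ condReal f x :=
  one_le_condReal S.one_le_card S.one_le_deg S.norm_eq_one S.isInvertible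

theorem one_le_D (S : StepData f g x) : (1 : ℝ) ≤ maxDeg d := by
  exact_mod_cast one_le_maxDeg S.one_le_card S.one_le_deg

theorem supNorm_pos (S : StepData f g x) : 0 < supNorm f := by
  have h := S.one_le_cond
  refine (supNorm_nonneg f).lt_of_ne fun h0 => ?_
  rw [condReal, ← h0] at h
  norm_num at h

theorem perturbation_le (S : StepData f g x) :
    maxDeg d * condReal f x * (invNorm f x * (√n * supNorm (g - f))) ≤ 0.03 := by
  have h := S.close
  have hS := S.supNorm_pos
  have h1 : maxDeg d * condReal f x * (invNorm f x * (√n * supNorm (g - f))) * supNorm f =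
      maxDeg d * condReal f x ^ 2 * supNorm (g - f) := by
    unfold condReal; ring
  rw [← h1] at h
  exact le_of_mul_le_mul_right h hS

theorem perturbation_le' (S : StepData f g x) :
    invNorm f x * (√n * supNorm (g - f)) ≤ 0.03 := by
  refine le_trans ?_ S.perturbation_le
  have h0 := supNorm_nonneg (g - f)
  have h1 := invNorm_nonneg f x
  exact le_mul_of_one_le_left (by positivity)
    (one_le_mul_of_one_le_of_one_le S.one_le_D S.one_le_cond)

theorem supNorm_sub_le (S : StepData f g x) : supNorm (g - f) ≤ 0.03 * supNorm f := by
  refine le_trans ?_ S.close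
  exact le_mul_of_one_le_left (supNorm_nonneg _)
    (one_le_mul_of_one_le_of_one_le S.one_le_D (one_le_pow₀ S.one_le_cond))

theorem supNorm_right_le (S : StepData f g x) : supNorm g ≤ 1.03 * supNorm f := by
  have := supNorm_le_add_sub g f
  linarith [S.supNorm_sub_le]

theorem le_supNorm_right (S : StepData f g x) : 0.97 * supNorm f ≤ supNorm g := by
  have := supNorm_le_add_sub f g
  rw [supNorm_sub_comm] at this
  linarith [S.supNorm_sub_le]

theorem invNorm_mul_le (S : StepData f g x) :
    invNorm f x * (√n * supNorm g) ≤ 1.03 * condReal f x := by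
  have h1 := invNorm_nonneg f x
  calc invNorm f x * (√n * supNorm g) ≤ invNorm f x * (√n * (1.03 * supNorm f)) := by
        gcongr; exact S.supNorm_right_le
    _ = _ := by unfold condReal; ring

theorem small_of_le (S : StepData f g x) {t b : ℝ} (ht : 0 ≤ t)
    (h : maxDeg d * condReal f x * t ≤ b) : maxDeg d * t ≤ b := by
  refine le_trans ?_ h
  have := S.one_le_cond
  have : (0 : ℝ) ≤ maxDeg d := by positivity
  gcongr
  nlinarith

/-- At most 0.03 comes from changing the system and 1.03·1.6·0.037 < 0.061 from moving by h. -/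
theorem invNorm_mul_sum_le (S : StepData f g x) {t : ℝ} (ht : 0 ≤ t)
    (h : maxDeg d * condReal f x * t ≤ 0.037) :
    invNorm f x * (√n * (supNorm (g - f) + supNorm g * (1.6 * maxDeg d * t))) ≤ 0.091 := by
  have h1 := S.perturbation_le'
  have h3 := S.invNorm_mul_le
  have h2 : invNorm f x * (√n * supNorm g) * (1.6 * maxDeg d * t) ≤
      1.03 * condReal f x * (1.6 * maxDeg d * t) := by
    gcongr
  nlinarith

/-- For X = D·M·‖h‖ the comparison of the two expansions reads X ≤ 0.03 + 1.648X² + 1.6·0.003² +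
0.03X + 0.003. At X = 0.037 the right side is below 0.0365. Excluding this single value is enough,
as continuity does the rest. -/
theorem radius_ne (S : StepData f g x) {h₀ h y₀ y : Cvec n} {c₀ c : ℂ}
    (H₀ : ZeroChart f x h₀ y₀ c₀) (H : ZeroChart g x h y c)
    (h0 : maxDeg d * condReal f x * ‖h₀‖ ≤ 0.003) :
    maxDeg d * condReal f x * ‖h‖ ≠ 0.037 := by
  intro hX
  have hD := S.one_le_D
  have hM := S.one_le_cond
  have hν := invNorm_nonneg f x
  have hsm := S.small_of_le (norm_nonneg h) hX.le
  have hsm0 := S.small_of_le (norm_nonneg h₀) h0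
  have h1 := H₀.norm_sub_le H S.one_le_deg (by linarith) (by linarith) hν
    (invBound_invNorm S.one_le_deg S.isInvertible)
  have hp := S.perturbation_le
  have hp' := S.perturbation_le'
  have hg := S.invNorm_mul_le
  set M := condReal f x with hMdef
  set D : ℝ := (maxDeg d : ℝ)
  set p := invNorm f x * (√n * supNorm (g - f)) with hpdef
  set q := invNorm f x * (√n * supNorm g) with hqdef
  have h2 : ‖h - h₀‖ ≤ p + q * (1.6 * D * ‖h‖ ^ 2) + M * (1.6 * D * ‖h₀‖ ^ 2) + p * ‖h‖ := by
    refine h1.trans (le_of_eq ?_)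
    rw [hpdef, hqdef, hMdef, condReal]; ring
  have hDM : 0 ≤ D * M := by positivity
  have h3 : ‖h‖ ≤ ‖h - h₀‖ + ‖h₀‖ := by
    have := norm_add_le (h - h₀) h₀
    rwa [sub_add_cancel] at this
  have h4 : q * (1.6 * D * ‖h‖ ^ 2) ≤ 1.03 * M * (1.6 * D * ‖h‖ ^ 2) := by gcongr
  have h5 : D * M * ‖h‖ ≤ D * M * (p + 1.03 * M * (1.6 * D * ‖h‖ ^ 2) +
      M * (1.6 * D * ‖h₀‖ ^ 2) + p * ‖h‖ + ‖h₀‖) := by gcongr; linarith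
  have h6 : D * M * (p + 1.03 * M * (1.6 * D * ‖h‖ ^ 2) +
      M * (1.6 * D * ‖h₀‖ ^ 2) + p * ‖h‖ + ‖h₀‖) = D * M * p + 1.648 * (D * M * ‖h‖) ^ 2 +
      1.6 * (D * M * ‖h₀‖) ^ 2 + p * (D * M * ‖h‖) + D * M * ‖h₀‖ := by ring
  rw [h6, hX] at h5
  have h7 : (D * M * ‖h₀‖) ^ 2 ≤ 0.003 ^ 2 := by gcongr
  nlinarith

theorem invBound_zero (S : StepData f g x) {h y : Cvec n} {c : ℂ} (H : ZeroChart g x h y c)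
    (hX : maxDeg d * condReal f x * ‖h‖ ≤ 0.037) :
    InvBound g y (1.102 * invNorm f x) := by
  have hsm := S.small_of_le (norm_nonneg h) hX
  have hν := invNorm_nonneg f x
  refine (H.invBound_right S.one_le_deg (by linarith) hν
    (invBound_invNorm S.one_le_deg S.isInvertible)
    (S.invNorm_mul_sum_le (norm_nonneg h) hX) (by norm_num)).mono ?_
  rw [div_le_iff₀ (by norm_num)]
  nlinarith

theorem invNorm_le (S : StepData f g x) {h y : Cvec n} {c : ℂ} (H : ZeroChart g x h y c)
    (hX : maxDeg d * condReal f x * ‖h‖ ≤ 0.037) (hy : (tangentDeriv g y).IsInvertible) :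
    invNorm f x ≤ 1.0925 * invNorm g y := by
  have hsm := S.small_of_le (norm_nonneg h) hX
  have hν := invNorm_nonneg g y
  have := H.invNorm_left_le S.one_le_deg (one_le_maxDeg S.one_le_card S.one_le_deg)
    (by linarith) hν (invBound_invNorm S.one_le_deg hy)
    (S.invNorm_mul_sum_le (norm_nonneg h) hX)
  linarith

theorem invBound_perturb (S : StepData f g x) : InvBound g x (1.031 * invNorm f x) := by
  have hν := invNorm_nonneg f x
  refine ((invBound_invNorm S.one_le_deg S.isInvertible).perturb S.one_le_deg S.norm_eq_one hν
    S.perturbation_le' (by norm_num)).mono ?_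
  rw [div_le_iff₀ (by norm_num)]
  nlinarith

theorem right_isInvertible (S : StepData f g x) : (tangentDeriv g x).IsInvertible :=
  S.invBound_perturb.isInvertible (by have := S.norm_eq_one; rintro rfl; simp at this)

end StepData

theorem ZeroChart.chartVec_newton {g : HomSys n d} {x h y x' : Cvec n} {c α : ℂ}
    (H : ZeroChart g x h y c) (hx' : ‖x'‖ = 1) (hα : x' = α • newtonVec g x) {e : ℝ}
    (he : ‖x + h - newtonVec g x‖ ≤ e) (he1 : e ≤ 0.03) :
    1 - ‖(inner ℂ x' y : ℂ)‖ ^ 2 ≤ e ^ 2 ∧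
      (inner ℂ x' y : ℂ) ≠ 0 ∧ ‖chartVec x' y‖ ≤ 1.001 * e := by
  have he0 : 0 ≤ e := (norm_nonneg _).trans he
  have h1 := one_sub_norm_inner_sq_le_of_smul hx' H.norm_right hα H.one_le_norm H.add_eq
  have h2 : 1 - ‖(inner ℂ x' y : ℂ)‖ ^ 2 ≤ e ^ 2 := h1.trans (by gcongr)
  exact ⟨h2, norm_chartVec_le hx' H.norm_right he0 he1 h2⟩

theorem StepData.newton {f g : HomSys n d} {x : Cvec n} (S : StepData f g x) {h y x' : Cvec n}
    {c α : ℂ} (H : ZeroChart g x h y c) (hX : maxDeg d * condReal f x * ‖h‖ ≤ 0.037)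
    (hx' : ‖x'‖ = 1) (hα : x' = α • newtonVec g x) :
    (tangentDeriv g x').IsInvertible ∧ (inner ℂ x' y : ℂ) ≠ 0 ∧
      maxDeg d * condReal g x' * ‖chartVec x' y‖ ≤ 0.003 := by
  have hν := invNorm_nonneg f x
  have hD := S.one_le_D
  have hM := S.one_le_cond
  have hsm := S.small_of_le (norm_nonneg h) hX
  have hg0 := supNorm_nonneg g
  have h1 := H.norm_add_sub_newtonVec_le S.one_le_deg (by linarith) (by positivity)
    S.invBound_perturb
  have hq := S.invNorm_mul_le
  set e := ‖x + h - newtonVec g x‖ with he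
  have h2 : e ≤ 1.031 * (1.03 * condReal f x) * (1.6 * maxDeg d * ‖h‖ ^ 2) := by
    calc e ≤ _ := h1
      _ = 1.031 * (invNorm f x * (√n * supNorm g)) * (1.6 * maxDeg d * ‖h‖ ^ 2) := by ring
      _ ≤ _ := by gcongr
  -- The error scaled by D·M is quadratic in X; the barrier 0.037 is small enough for its square to
  -- fall under the invariant.
  have h3 : maxDeg d * condReal f x * e ≤ 0.00233 := by
    calc maxDeg d * condReal f x * e ≤ maxDeg d * condReal f x *
          (1.031 * (1.03 * condReal f x) * (1.6 * maxDeg d * ‖h‖ ^ 2)) := by gcongr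
      _ = 1.031 * 1.03 * 1.6 * (maxDeg d * condReal f x * ‖h‖) ^ 2 := by ring
      _ ≤ 1.031 * 1.03 * 1.6 * 0.037 ^ 2 := by gcongr
      _ ≤ 0.00233 := by norm_num
  have hDe := S.small_of_le (norm_nonneg _) h3
  have he1 : e ≤ 0.03 := by nlinarith [norm_nonneg (x + h - newtonVec g x)]
  obtain ⟨-, hne, ht⟩ := H.chartVec_newton hx' hα le_rfl he1
  rw [← he] at ht
  set t := ‖chartVec x' y‖ with htdef
  have ht0 : 0 ≤ t := norm_nonneg _
  have H' := zeroChart_chartVec hx' H.norm_right hne H.zero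
  have hDt : maxDeg d * t ≤ 0.04 := by
    calc maxDeg d * t ≤ maxDeg d * (1.001 * e) := by gcongr
      _ ≤ 0.04 := by linarith
  have hDMt : maxDeg d * condReal f x * t ≤ 0.002333 := by
    calc maxDeg d * condReal f x * t ≤ maxDeg d * condReal f x * (1.001 * e) := by gcongr
      _ ≤ 0.002333 := by linarith
  have hqt : invNorm f x * (√n * supNorm g) * (maxDeg d * t) ≤ 1.03 * 0.002333 := by
    calc invNorm f x * (√n * supNorm g) * (maxDeg d * t)
        ≤ 1.03 * condReal f x * (maxDeg d * t) := by gcongr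
      _ = 1.03 * (maxDeg d * condReal f x * t) := by ring
      _ ≤ _ := by gcongr
  -- The condition at the new point is reached through the common zero: from f at x to g at y, then
  -- from g at y to g at x'.
  have h4 : InvBound g x' (1.001 * (1.102 * invNorm f x) / (1 - 0.0043)) := by
    refine H'.invBound_left S.one_le_deg (one_le_maxDeg S.one_le_card S.one_le_deg) hDt
      (by positivity) (S.invBound_zero H hX) ?_ (by norm_num)
    rw [supNorm_sub_self, zero_add]
    calc 1.001 * (1.102 * invNorm f x) * (√n * (supNorm g * (1.6 * maxDeg d * t)))
        = 1.001 * 1.102 * 1.6 * (invNorm f x * (√n * supNorm g) * (maxDeg d * t)) := by ring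
      _ ≤ 1.001 * 1.102 * 1.6 * (1.03 * 0.002333) := by gcongr
      _ ≤ _ := by norm_num
  have h5 := h4.invNorm_le S.one_le_deg H'.left_ne_zero (by positivity)
  refine ⟨h4.isInvertible H'.left_ne_zero, hne, ?_⟩
  have h6 : invNorm g x' ≤ 1.108 * invNorm f x := by
    refine h5.trans ?_
    rw [div_le_iff₀ (by norm_num)]
    linarith
  calc maxDeg d * condReal g x' * t
      = √n * supNorm g * invNorm g x' * (maxDeg d * t) := by unfold condReal; ring
    _ ≤ √n * supNorm g * (1.108 * invNorm f x) * (maxDeg d * t) := by gcongr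
    _ = 1.108 * (invNorm f x * (√n * supNorm g) * (maxDeg d * t)) := by ring
    _ ≤ 1.108 * (1.03 * 0.002333) := by gcongr
    _ ≤ 0.003 := by norm_num

/-! ### Newton's method near a nonsingular zero of a fixed system. -/

namespace ZeroChart

variable {f : HomSys n d} {x h y x' : Cvec n} {c α : ℂ}

/-- Moves the invariant to the condition number at the zero, which stays fixed during the Newton
iteration; the price is 0.0031 for 0.003. -/
theorem cond_right (H : ZeroChart f x h y c) (hn : 1 ≤ n) (hd : ∀ i, 1 ≤ d i)
    (hx : (tangentDeriv f x).IsInvertible) (hX : maxDeg d * condReal f x * ‖h‖ ≤ 0.003) :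
    maxDeg d * condReal f y * ‖h‖ ≤ 0.0031 := by
  have hf := supNorm_nonneg f
  have S : StepData f f x := ⟨hn, hd, H.norm_left, hx, by
    rw [supNorm_sub_self, mul_zero]; positivity⟩
  have hsm := S.small_of_le (norm_nonneg h) hX
  have hν := invNorm_nonneg f x
  have h1 : InvBound f y (1.001 * invNorm f x / (1 - 0.0048)) := by
    refine H.invBound_right hd (by linarith) hν (invBound_invNorm hd hx) ?_ (by norm_num)
    rw [supNorm_sub_self, zero_add]
    calc invNorm f x * (√n * (supNorm f * (1.6 * maxDeg d * ‖h‖)))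
        = 1.6 * (maxDeg d * condReal f x * ‖h‖) := by unfold condReal; ring
      _ ≤ 1.6 * 0.003 := by gcongr
      _ ≤ _ := by norm_num
  have h2 : invNorm f y ≤ 1.006 * invNorm f x := by
    refine (h1.invNorm_le hd H.right_ne_zero (by positivity)).trans ?_
    rw [div_le_iff₀ (by norm_num)]
    linarith
  calc maxDeg d * condReal f y * ‖h‖ = √n * supNorm f * invNorm f y * (maxDeg d * ‖h‖) := by
        unfold condReal; ring
    _ ≤ √n * supNorm f * (1.006 * invNorm f x) * (maxDeg d * ‖h‖) := by gcongr
    _ = 1.006 * (maxDeg d * condReal f x * ‖h‖) := by unfold condReal; ring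
    _ ≤ 1.006 * 0.003 := by gcongr
    _ ≤ _ := by norm_num

theorem invBound_of_right (H : ZeroChart f x h y c) (hn : 1 ≤ n) (hd : ∀ i, 1 ≤ d i)
    (hy : (tangentDeriv f y).IsInvertible) (hX : maxDeg d * condReal f y * ‖h‖ ≤ 0.0031) :
    InvBound f x (1.007 * invNorm f y) := by
  have hf := supNorm_nonneg f
  have S : StepData f f y := ⟨hn, hd, H.norm_right, hy, by
    rw [supNorm_sub_self, mul_zero]; positivity⟩
  have hsm := S.small_of_le (norm_nonneg h) hX
  have hκ := invNorm_nonneg f y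
  refine (H.invBound_left (e := 0.005) hd (one_le_maxDeg hn hd) (by linarith) hκ
    (invBound_invNorm hd hy) ?_ (by norm_num)).mono ?_
  · rw [supNorm_sub_self, zero_add]
    calc 1.001 * invNorm f y * (√n * (supNorm f * (1.6 * maxDeg d * ‖h‖)))
        = 1.001 * 1.6 * (maxDeg d * condReal f y * ‖h‖) := by unfold condReal; ring
      _ ≤ 1.001 * 1.6 * 0.0031 := by gcongr
      _ ≤ _ := by norm_num
  · rw [div_le_iff₀ (by norm_num)]
    linarith

/-- Quadratic convergence of Newton's operator close to a zero `y`. -/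
theorem newton_quadratic (H : ZeroChart f x h y c) (hn : 1 ≤ n) (hd : ∀ i, 1 ≤ d i)
    (hy : (tangentDeriv f y).IsInvertible) (hX : maxDeg d * condReal f y * ‖h‖ ≤ 0.0031)
    (hx' : ‖x'‖ = 1) (hα : x' = α • newtonVec f x) :
    (inner ℂ x' y : ℂ) ≠ 0 ∧ maxDeg d * condReal f y * ‖chartVec x' y‖ ≤ 0.0031 ∧
      1 - ‖(inner ℂ x' y : ℂ)‖ ^ 2 ≤ (1.612 * (maxDeg d * condReal f y) * ‖h‖ ^ 2) ^ 2 := by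
  have hf := supNorm_nonneg f
  have S : StepData f f y := ⟨hn, hd, H.norm_right, hy, by
    rw [supNorm_sub_self, mul_zero]; positivity⟩
  have hsm := S.small_of_le (norm_nonneg h) hX
  have hκ := invNorm_nonneg f y
  have hD := S.one_le_D
  have hM := S.one_le_cond
  have hb := H.invBound_of_right hn hd hy hX
  have h1 : ‖x + h - newtonVec f x‖ ≤ 1.612 * (maxDeg d * condReal f y) * ‖h‖ ^ 2 := by
    calc _ ≤ _ := H.norm_add_sub_newtonVec_le hd (by linarith) (by positivity) hb
      _ = 1.007 * 1.6 * (maxDeg d * condReal f y) * ‖h‖ ^ 2 := by unfold condReal; ring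
      _ ≤ _ := by gcongr; norm_num
  have hh : ‖h‖ ≤ 0.0031 := by nlinarith [norm_nonneg h]
  have h2 : 1.612 * (maxDeg d * condReal f y) * ‖h‖ ^ 2 ≤ 0.9 * ‖h‖ := by
    calc 1.612 * (maxDeg d * condReal f y) * ‖h‖ ^ 2
        = 1.612 * (maxDeg d * condReal f y * ‖h‖) * ‖h‖ := by ring
      _ ≤ 1.612 * 0.0031 * ‖h‖ := by gcongr
      _ ≤ _ := by gcongr; norm_num
  obtain ⟨h3, hne, h4⟩ := H.chartVec_newton hx' hα h1 (by linarith)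
  refine ⟨hne, ?_, h3⟩
  have h5 : ‖chartVec x' y‖ ≤ ‖h‖ := by linarith [norm_nonneg h]
  refine le_trans ?_ hX
  gcongr

end ZeroChart

/-! ### Angles, sines and inner products. -/

section Angle

variable {E : Type*} [NormedAddCommGroup E] [InnerProductSpace ℂ E]

theorem norm_sub_inner_smul_sq {x y : E} (hx : ‖x‖ = 1) (hy : ‖y‖ = 1) :
    ‖y - (inner ℂ x y : ℂ) • x‖ ^ 2 = 1 - ‖(inner ℂ x y : ℂ)‖ ^ 2 := by
  have h0 : (inner ℂ x (y - (inner ℂ x y : ℂ) • x) : ℂ) = 0 := by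
    rw [inner_sub_right, inner_smul_right, inner_self_eq_norm_sq_to_K, hx]
    simp
  have h1 := norm_add_sq_eq_norm_sq_add_norm_sq_of_inner_eq_zero (𝕜 := ℂ)
    ((inner ℂ x y : ℂ) • x) (y - (inner ℂ x y : ℂ) • x) (by rw [inner_smul_left, h0, mul_zero])
  rw [add_sub_cancel, norm_smul, hx, hy, mul_one] at h1
  linarith

theorem norm_inner_le_one {x y : E} (hx : ‖x‖ = 1) (hy : ‖y‖ = 1) :
    ‖(inner ℂ x y : ℂ)‖ ≤ 1 := by
  simpa [hx, hy] using norm_inner_le_norm (𝕜 := ℂ) x y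

theorem sqrt_one_sub_sq_le_arccos (c : ℝ) : √(1 - c ^ 2) ≤ Real.arccos c := by
  rw [← Real.sin_arccos]
  exact Real.sin_le (Real.arccos_nonneg c)

theorem one_sub_sq_le_arccos_sq (c : ℝ) : 1 - c ^ 2 ≤ Real.arccos c ^ 2 := by
  have := sqrt_one_sub_sq_le_arccos c
  rwa [Real.sqrt_le_left (Real.arccos_nonneg c)] at this

/-- Jordan's inequality: an angle in [0, π/2] is at most π/2 < 1.571 times its sine. -/
theorem arccos_le_of_one_sub_sq_le {c s : ℝ} (hc : 0 ≤ c) (hs : 0 ≤ s) (h : 1 - c ^ 2 ≤ s ^ 2) :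
    Real.arccos c ≤ 1.571 * s := by
  have h1 : √(1 - c ^ 2) ≤ s := (Real.sqrt_le_left hs).mpr h
  have h2 := Real.mul_le_sin (Real.arccos_nonneg c) (Real.arccos_le_pi_div_two.mpr hc)
  rw [Real.sin_arccos] at h2
  have hpi := Real.pi_pos
  have h3 : Real.arccos c ≤ Real.pi / 2 * s := by
    have : 2 / Real.pi * Real.arccos c ≤ s := h2.trans h1
    rw [div_mul_eq_mul_div, div_le_iff₀ hpi] at this
    linarith
  have := Real.pi_lt_d4
  nlinarith

/-- Split y' into its component along y and an orthogonal part, whose length is the sine of the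
angle. This replaces a triangle inequality for the projective distance. -/
theorem abs_norm_inner_sub_le {x y y' : E} (hx : ‖x‖ = 1) (hy : ‖y‖ = 1) (hy' : ‖y'‖ = 1) :
    |‖(inner ℂ x y : ℂ)‖ - ‖(inner ℂ x y' : ℂ)‖| ≤ Real.arccos ‖(inner ℂ y y' : ℂ)‖ := by
  have key : ∀ y y' : E, ‖y‖ = 1 → ‖y'‖ = 1 →
      ‖(inner ℂ x y' : ℂ)‖ ≤ ‖(inner ℂ x y : ℂ)‖ + Real.arccos ‖(inner ℂ y y' : ℂ)‖ := by
    intro y y' hy hy'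
    set c := (inner ℂ y y' : ℂ)
    have h1 : (inner ℂ x y' : ℂ) = c * inner ℂ x y + inner ℂ x (y' - c • y) := by
      rw [inner_sub_right, inner_smul_right]; ring
    have h2 : ‖y' - c • y‖ ≤ Real.arccos ‖c‖ :=
      (sq_le_sq₀ (norm_nonneg _) (Real.arccos_nonneg _)).mp
        ((norm_sub_inner_smul_sq hy hy').le.trans (one_sub_sq_le_arccos_sq _))
    have h3 := norm_inner_le_norm (𝕜 := ℂ) x (y' - c • y)
    rw [hx, one_mul] at h3
    rw [h1]
    refine (norm_add_le _ _).trans (add_le_add ?_ (h3.trans h2))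
    rw [norm_mul]
    exact mul_le_of_le_one_left (norm_nonneg _) (norm_inner_le_one hy hy')
  have h1 := key y y' hy hy'
  have h2 := key y' y hy' hy
  rw [norm_inner_symm y' y] at h2
  rw [abs_le]
  constructor <;> linarith

end Angle

/-! ### Newton's operator on projective space and approximate zeros. -/

section Projective

theorem norm_unitRep (z : CProj n) : ‖unitRep z‖ = 1 := by
  have : ‖z.rep‖ ≠ 0 := norm_ne_zero_iff.mpr z.rep_nonzero
  rw [unitRep, norm_smul, Complex.norm_real, norm_inv, norm_norm, inv_mul_cancel₀ this]

theorem exists_unitRep_mk {v : Cvec n} (hv : v ≠ 0) :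
    ∃ α : ℂ, unitRep (Projectivization.mk ℂ v hv) = α • v := by
  obtain ⟨a, ha⟩ := Projectivization.exists_smul_eq_mk_rep ℂ v hv
  exact ⟨_, by rw [unitRep, ← ha, Units.smul_def, smul_smul]⟩

theorem exists_newton {f : HomSys n d} {z : CProj n} (h : IsNonsingularAt f z) :
    ∃ (z' : CProj n) (α : ℂ), newton f z = some z' ∧ unitRep z' = α • newtonVec f (unitRep z) := by
  obtain ⟨α, hα⟩ := exists_unitRep_mk (newtonVec_ne_zero f (unitRep_ne_zero z))
  exact ⟨_, α, if_pos h, hα⟩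

theorem cond_eq {f : HomSys n d} {z : CProj n} (h : IsNonsingularAt f z) :
    cond f z = ENNReal.ofReal (condReal f (unitRep z)) := if_pos h

/-- The affine chart at `unitRep z`, with the zero `w` of `f`. -/
theorem zeroChart_unitRep {f : HomSys n d} {z w : CProj n} (hw : IsZeroAt f w)
    (h : (inner ℂ (unitRep z) (unitRep w) : ℂ) ≠ 0) :
    ZeroChart f (unitRep z) (chartVec (unitRep z) (unitRep w)) (unitRep w)
      (inner ℂ (unitRep z) (unitRep w) : ℂ)⁻¹ :=
  zeroChart_chartVec (norm_unitRep z) (norm_unitRep w) h hw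

/-- With A = D·M at ζ, the angles satisfy θ' ≤ 2.6Aθ², where 2.6 exceeds 1.571·1.612·1.0001, and
2.6Aθ ≤ 1/2 at the start. The exponents match because 2(2^k - 1) + 1 = 2^(k+1) - 1. -/
theorem isApproxZero_of_chartVec (hn : 1 ≤ n) (hd : ∀ i, 1 ≤ d i) {f : HomSys n d}
    {z ζ : CProj n} (hζ : IsZeroAt f ζ) (hns : IsNonsingularAt f ζ)
    (hne : (inner ℂ (unitRep z) (unitRep ζ) : ℂ) ≠ 0)
    (h : maxDeg d * condReal f (unitRep ζ) * ‖chartVec (unitRep z) (unitRep ζ)‖ ≤ 0.0031) :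
    IsApproxZero f z ζ := by
  refine ⟨hζ, ?_⟩
  set y := unitRep ζ with hy
  have hy1 : ‖y‖ = 1 := norm_unitRep ζ
  set A := maxDeg d * condReal f y with hA
  have hD : (1 : ℝ) ≤ maxDeg d := by exact_mod_cast one_le_maxDeg hn hd
  have hM := one_le_condReal hn hd hy1 hns
  have hA1 : 1 ≤ A := one_le_mul_of_one_le_of_one_le hD hM
  set θ := distP z ζ with hθ
  have hθ0 : 0 ≤ θ := Real.arccos_nonneg _
  have hsin : ∀ w : CProj n, (inner ℂ (unitRep w) y : ℂ) ≠ 0 →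
      1 - ‖(inner ℂ (unitRep w) y : ℂ)‖ ^ 2 ≤ ‖chartVec (unitRep w) y‖ ^ 2 ∧
      ‖chartVec (unitRep w) y‖ ^ 2 = (1 - ‖(inner ℂ (unitRep w) y : ℂ)‖ ^ 2) *
        (1 + ‖chartVec (unitRep w) y‖ ^ 2) := by
    intro w hw
    have h1 := norm_inner_sq_mul (norm_unitRep w) hy1 hw
    have h2 := norm_inner_le_one (norm_unitRep w) hy1
    have h3 := norm_nonneg (inner ℂ (unitRep w) y : ℂ)
    constructor <;> nlinarith [sq_nonneg ‖chartVec (unitRep w) y‖]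
  have hAθ : 2.6 * A * θ ≤ 1 / 2 := by
    have h1 : θ ≤ 1.571 * ‖chartVec (unitRep z) y‖ :=
      arccos_le_of_one_sub_sq_le (norm_nonneg _) (norm_nonneg _) (hsin z hne).1
    nlinarith
  have key : ∀ k : ℕ, ∃ w, newtonIter f k z = some w ∧ (inner ℂ (unitRep w) y : ℂ) ≠ 0 ∧
      A * ‖chartVec (unitRep w) y‖ ≤ 0.0031 ∧ distP w ζ ≤ (1 / 2 : ℝ) ^ (2 ^ k - 1) * θ := by
    intro k
    induction k with
    | zero => exact ⟨z, rfl, hne, h, by simp [hθ]⟩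
    | succ k ih =>
      obtain ⟨w, hw, hwne, hwA, hwθ⟩ := ih
      have H := zeroChart_unitRep (z := w) hζ hwne
      have hinv : IsNonsingularAt f w :=
        (H.invBound_of_right hn hd hns hwA).isInvertible H.left_ne_zero
      obtain ⟨w', α, hw', hα⟩ := exists_newton hinv
      obtain ⟨h1, h2, h3⟩ := H.newton_quadratic hn hd hns hwA (norm_unitRep w') hα
      refine ⟨w', by rw [newtonIter, hw]; exact hw', h1, h2, ?_⟩
      set t := ‖chartVec (unitRep w) y‖ with ht
      have ht0 : 0 ≤ t := norm_nonneg _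
      have h4 : distP w' ζ ≤ 1.571 * (1.612 * A * t ^ 2) :=
        arccos_le_of_one_sub_sq_le (norm_nonneg _) (by positivity) h3
      have h5 : t ^ 2 ≤ 1.0001 * distP w ζ ^ 2 := by
        have h6 : 1 - ‖(inner ℂ (unitRep w) y : ℂ)‖ ^ 2 ≤ distP w ζ ^ 2 :=
          one_sub_sq_le_arccos_sq _
        have h7 : t ≤ 0.0031 := by nlinarith
        have h8 : 1 + t ^ 2 ≤ 1.0001 := by nlinarith
        rw [(hsin w hwne).2, mul_comm]
        exact mul_le_mul h8 h6 (sub_nonneg.mpr (pow_le_one₀ (norm_nonneg _)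
          (norm_inner_le_one (norm_unitRep w) hy1))) (by norm_num)
      have h6 : distP w' ζ ≤ 2.6 * A * distP w ζ ^ 2 := by
        calc distP w' ζ ≤ 1.571 * (1.612 * A * t ^ 2) := h4
          _ ≤ 1.571 * (1.612 * A * (1.0001 * distP w ζ ^ 2)) := by gcongr
          _ = 1.571 * 1.612 * 1.0001 * A * distP w ζ ^ 2 := by ring
          _ ≤ _ := by gcongr; norm_num
      have h7 : distP w ζ ^ 2 ≤ ((1 / 2 : ℝ) ^ (2 ^ k - 1) * θ) ^ 2 := by
        gcongr
        exact Real.arccos_nonneg _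
      have h8 : (1 / 2 : ℝ) ^ (2 ^ (k + 1) - 1) = 1 / 2 * ((1 / 2 : ℝ) ^ (2 ^ k - 1)) ^ 2 := by
        rw [← pow_mul, ← pow_succ']
        congr 1
        have : 1 ≤ 2 ^ k := Nat.one_le_two_pow
        rw [pow_succ]
        omega
      calc distP w' ζ ≤ 2.6 * A * ((1 / 2 : ℝ) ^ (2 ^ k - 1) * θ) ^ 2 := h6.trans (by gcongr)
        _ = 2.6 * A * θ * (((1 / 2 : ℝ) ^ (2 ^ k - 1)) ^ 2 * θ) := by ring
        _ ≤ 1 / 2 * (((1 / 2 : ℝ) ^ (2 ^ k - 1)) ^ 2 * θ) := by gcongr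
        _ = _ := by rw [h8]; ring
  intro k
  obtain ⟨w, hw, -, -, hwθ⟩ := key k
  exact ⟨w, hw, hwθ⟩

end Projective

/-! ### Following the lifted path during one step. -/

section Path

variable {f g : HomSys n d} {ζ : CProj n} {γ : ℝ → CProj n}

theorem seg_sub_seg (f g : HomSys n d) (s t : ℝ) :
    seg f g s - seg f g t = ((s - t : ℝ) : ℂ) • (f - g) := by
  unfold seg
  push_cast
  module

theorem supNorm_seg_sub_le (f g : HomSys n d) (s t : ℝ) :
    supNorm (seg f g s - seg f g t) ≤ |s - t| * supNorm (f - g) := by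
  rw [seg_sub_seg]
  refine (supNorm_smul_le _ _).trans (le_of_eq ?_)
  rw [Complex.norm_real, Real.norm_eq_abs]

theorem seg_one (f g : HomSys n d) : seg f g 1 = f := by
  simp [seg]

theorem IsLifting.continuousOn_norm_inner (hγ : IsLifting f g ζ γ) {x : Cvec n} (hx : ‖x‖ = 1) :
    ContinuousOn (fun t => ‖(inner ℂ x (unitRep (γ t)) : ℂ)‖) (Set.Icc 0 1) := by
  intro t ht
  rw [ContinuousWithinAt, tendsto_iff_dist_tendsto_zero]
  refine squeeze_zero (fun _ => dist_nonneg) (fun s => ?_) (hγ.cont t ht)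
  rw [Real.dist_eq]
  exact abs_norm_inner_sub_le hx (norm_unitRep _) (norm_unitRep _)

/-- The current approximation `z` follows the zero `γ t` of `q_t` closely. -/
structure Tracks (f g : HomSys n d) (γ : ℝ → CProj n) (t : ℝ) (z : CProj n) : Prop where
  nonsingular : IsNonsingularAt (seg f g t) z
  inner_ne_zero : (inner ℂ (unitRep z) (unitRep (γ t)) : ℂ) ≠ 0
  close : maxDeg d * condReal (seg f g t) (unitRep z) *
    ‖chartVec (unitRep z) (unitRep (γ t))‖ ≤ 0.003

/-- The step from time `t` to time `t'` is as short as the algorithm requires it to be. -/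
def ShortStep (f g : HomSys n d) (t t' : ℝ) (z : CProj n) : Prop :=
  maxDeg d * condReal (seg f g t) (unitRep z) ^ 2 * ((t' - t) * supNorm (f - g)) ≤
    0.03 * supNorm (seg f g t)

theorem Tracks.stepData (hn : 1 ≤ n) (hd : ∀ i, 1 ≤ d i) {t t' τ : ℝ} {z : CProj n}
    (T : Tracks f g γ t z) (hs : ShortStep f g t t' z) (hτ : τ ∈ Set.Icc t t') :
    StepData (seg f g t) (seg f g τ) (unitRep z) := by
  refine ⟨hn, hd, norm_unitRep z, T.nonsingular, le_trans ?_ hs⟩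
  have h0 := supNorm_nonneg (f - g)
  gcongr
  refine (supNorm_seg_sub_le f g τ t).trans ?_
  rw [abs_of_nonneg (by linarith [hτ.1])]
  gcongr
  exact hτ.2

theorem Tracks.chart_le (hn : 1 ≤ n) (hd : ∀ i, 1 ≤ d i) (hγ : IsLifting f g ζ γ) {t t' : ℝ}
    (ht : 0 ≤ t) (ht' : t' ≤ 1) {z : CProj n} (T : Tracks f g γ t z)
    (hs : ShortStep f g t t' z) {τ : ℝ} (hτ : τ ∈ Set.Icc t t') :
    (inner ℂ (unitRep z) (unitRep (γ τ)) : ℂ) ≠ 0 ∧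
      maxDeg d * condReal (seg f g t) (unitRep z) *
        ‖chartVec (unitRep z) (unitRep (γ τ))‖ ≤ 0.037 := by
  have h01 : ∀ s ∈ Set.Icc t t', s ∈ Set.Icc (0 : ℝ) 1 := fun s h => ⟨ht.trans h.1, h.2.trans ht'⟩
  set x := unitRep z with hxdef
  have hx : ‖x‖ = 1 := norm_unitRep z
  have S := T.stepData hn hd hs hτ
  set B := maxDeg d * condReal (seg f g t) x with hB
  have hB1 : 1 ≤ B := one_le_mul_of_one_le_of_one_le S.one_le_D S.one_le_cond
  -- The barrier is put on the cosine, which is continuous even where the zero leaves the chart; c₀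
  -- is the cosine of the angle with tangent r = 0.037/B.
  set φ : ℝ → ℝ := fun s => ‖(inner ℂ x (unitRep (γ s)) : ℂ)‖ with hφ
  set r := 0.037 / B with hr
  have hBr : B * r = 0.037 := by rw [hr]; field_simp
  have hr0 : 0 < r := by positivity
  set c₀ := (√(1 + r ^ 2))⁻¹ with hc₀
  have hc₀0 : 0 < c₀ := by positivity
  have hc₀sq : c₀ ^ 2 * (1 + r ^ 2) = 1 := by
    rw [hc₀, inv_pow, Real.sq_sqrt (by positivity)]
    field_simp
  have hφeq : ∀ s, (inner ℂ x (unitRep (γ s)) : ℂ) ≠ 0 →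
      φ s ^ 2 * (1 + ‖chartVec x (unitRep (γ s))‖ ^ 2) = 1 := fun s h =>
    norm_inner_sq_mul hx (norm_unitRep _) h
  have htc : c₀ < φ t := by
    have h1 := hφeq t T.inner_ne_zero
    have h2 : ‖chartVec x (unitRep (γ t))‖ < r := by
      have := T.close
      by_contra! hge
      nlinarith
    have h3 : ‖chartVec x (unitRep (γ t))‖ ^ 2 < r ^ 2 := by gcongr
    have h4 : 0 ≤ φ t := norm_nonneg _
    by_contra! hle
    have h5 : φ t ^ 2 ≤ c₀ ^ 2 := by gcongr
    nlinarith [sq_nonneg ‖chartVec x (unitRep (γ t))‖, sq_pos_of_pos hc₀0]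
  have hne : ∀ s ∈ Set.Icc t t', φ s ≠ c₀ := by
    intro s hs' heq
    have hin : (inner ℂ x (unitRep (γ s)) : ℂ) ≠ 0 := by
      rw [← norm_ne_zero_iff]
      exact (heq.trans_ne hc₀0.ne')
    have h1 := hφeq s hin
    rw [heq] at h1
    have h2 : ‖chartVec x (unitRep (γ s))‖ = r := by
      have h3 : ‖chartVec x (unitRep (γ s))‖ ^ 2 = r ^ 2 := by
        have := mul_left_cancel₀ (by positivity) (h1.trans hc₀sq.symm)
        linarith
      exact (pow_left_inj₀ (norm_nonneg _) hr0.le two_ne_zero).mp h3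
    refine (T.stepData hn hd hs hs').radius_ne
      (zeroChart_unitRep (hγ.zero t (h01 t ⟨le_rfl, hτ.1.trans hτ.2⟩)) T.inner_ne_zero)
      (zeroChart_unitRep (hγ.zero s (h01 s hs')) hin) T.close ?_
    rw [h2]
    exact hBr
  have hτc : c₀ < φ τ := by
    by_contra! hle
    have hcont : ContinuousOn φ (Set.Icc t τ) :=
      (hγ.continuousOn_norm_inner hx).mono fun s h => h01 s ⟨h.1, h.2.trans hτ.2⟩
    obtain ⟨s, hs1, hs2⟩ := intermediate_value_Icc' hτ.1 hcont ⟨hle, htc.le⟩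
    exact hne s ⟨hs1.1, hs1.2.trans hτ.2⟩ hs2
  have hin : (inner ℂ x (unitRep (γ τ)) : ℂ) ≠ 0 := by
    rw [← norm_ne_zero_iff]
    exact (hc₀0.trans hτc).ne'
  refine ⟨hin, ?_⟩
  have h1 := hφeq τ hin
  have h2 : ‖chartVec x (unitRep (γ τ))‖ ≤ r := by
    by_contra! hlt
    have h3 : r ^ 2 < ‖chartVec x (unitRep (γ τ))‖ ^ 2 := by gcongr
    have h4 : c₀ ^ 2 < φ τ ^ 2 := by gcongr
    nlinarith [sq_nonneg r, sq_pos_of_pos hc₀0]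
  calc B * ‖chartVec x (unitRep (γ τ))‖ ≤ B * r := by gcongr
    _ = _ := hBr

theorem Tracks.exists_newton (hn : 1 ≤ n) (hd : ∀ i, 1 ≤ d i) (hγ : IsLifting f g ζ γ) {t t' : ℝ}
    (ht : 0 ≤ t) (htt' : t ≤ t') (ht' : t' ≤ 1) {z : CProj n} (T : Tracks f g γ t z)
    (hs : ShortStep f g t t' z) :
    ∃ z', newton (seg f g t') z = some z' ∧ Tracks f g γ t' z' := by
  have hτ : t' ∈ Set.Icc t t' := ⟨htt', le_rfl⟩
  have S := T.stepData hn hd hs hτ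
  obtain ⟨hne, hX⟩ := T.chart_le hn hd hγ ht ht' hs hτ
  obtain ⟨z', α, hz', hα⟩ := LinearHomotopy.exists_newton (z := z) S.right_isInvertible
  obtain ⟨h1, h2, h3⟩ := S.newton
    (zeroChart_unitRep (hγ.zero t' ⟨ht.trans htt', ht'⟩) hne) hX (norm_unitRep z') hα
  exact ⟨z', hz', h1, h2, h3⟩

/-- The integrand `M²(q_t, γ t) / ‖q_t‖_∞`. -/
def integrand (f g : HomSys n d) (γ : ℝ → CProj n) (t : ℝ) : ℝ≥0∞ :=
  cond (seg f g t) (γ t) ^ 2 / ENNReal.ofReal (supNorm (seg f g t))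

/-- After cancellation the integrand is linear in ‖q‖_∞, so comparing two systems costs one factor
1/0.97. -/
theorem integrand_eq (hn : 1 ≤ n) (hd : ∀ i, 1 ≤ d i) {t : ℝ}
    (h : IsNonsingularAt (seg f g t) (γ t)) :
    integrand f g γ t = ENNReal.ofReal
      (n * supNorm (seg f g t) * invNorm (seg f g t) (unitRep (γ t)) ^ 2) := by
  have h1 := one_le_condReal hn hd (norm_unitRep (γ t)) h
  have h0 : 0 < supNorm (seg f g t) := by
    refine (supNorm_nonneg _).lt_of_ne fun h0 => ?_
    rw [condReal, ← h0] at h1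
    norm_num at h1
  rw [integrand, cond_eq h, ← ENNReal.ofReal_pow (by linarith), ← ENNReal.ofReal_div_of_pos h0]
  congr 1
  rw [condReal, mul_pow, mul_pow, Real.sq_sqrt (by positivity)]
  field_simp

/-- Numerically, 1.0925²/0.97 < 1.25. -/
theorem mul_sq_le_of_ratio {s s' ν κ : ℝ} (hs : 0 ≤ s) (hν : 0 ≤ ν)
    (hss : 0.97 * s ≤ s') (hνκ : ν ≤ 1.0925 * κ) : s * ν ^ 2 ≤ s' * κ ^ 2 * 1.25 := by
  have h : ν ^ 2 ≤ (1.0925 * κ) ^ 2 := by gcongr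
  have h' : 0.97 * s * κ ^ 2 ≤ s' * κ ^ 2 := by gcongr
  have h'' : s * ν ^ 2 ≤ s * (1.0925 * κ) ^ 2 := by gcongr
  have : 0 ≤ s * κ ^ 2 := by positivity
  nlinarith

theorem Tracks.le_integrand (hn : 1 ≤ n) (hd : ∀ i, 1 ≤ d i) (hγ : IsLifting f g ζ γ)
    (hns : ∀ t ∈ Set.Icc (0 : ℝ) 1, IsNonsingularAt (seg f g t) (γ t)) {t t' : ℝ}
    (ht : 0 ≤ t) (ht' : t' ≤ 1) {z : CProj n} (T : Tracks f g γ t z)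
    (hs : ShortStep f g t t' z) {τ : ℝ} (hτ : τ ∈ Set.Icc t t') :
    ENNReal.ofReal (condReal (seg f g t) (unitRep z) ^ 2 / supNorm (seg f g t) / 1.25) ≤
      integrand f g γ τ := by
  have h01 : τ ∈ Set.Icc (0 : ℝ) 1 := ⟨ht.trans hτ.1, hτ.2.trans ht'⟩
  have S := T.stepData hn hd hs hτ
  obtain ⟨hne, hX⟩ := T.chart_le hn hd hγ ht ht' hs hτ
  rw [integrand_eq hn hd (hns τ h01)]
  refine ENNReal.ofReal_le_ofReal ?_
  have h1 := S.invNorm_le (zeroChart_unitRep (hγ.zero τ h01) hne) hX (hns τ h01)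
  have h2 := S.le_supNorm_right
  have h3 := S.supNorm_pos
  have h4 := invNorm_nonneg (seg f g t) (unitRep z)
  have h6 : condReal (seg f g t) (unitRep z) ^ 2 / supNorm (seg f g t) =
      n * (supNorm (seg f g t) * invNorm (seg f g t) (unitRep z) ^ 2) := by
    rw [condReal, mul_pow, mul_pow, Real.sq_sqrt (Nat.cast_nonneg n)]
    field_simp
  rw [h6, div_le_iff₀ (by norm_num), mul_assoc (n : ℝ), mul_assoc (n : ℝ)]
  refine mul_le_mul_of_nonneg_left ?_ (Nat.cast_nonneg n)
  exact mul_sq_le_of_ratio h3.le h4 h2 h1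

end Path

/-! ### Counting the steps and finiteness of the integral. -/

section Algorithm

variable {f g : HomSys n d} {ζ : CProj n} {γ : ℝ → CProj n}

theorem Tracks.supNorm_pos (hn : 1 ≤ n) (hd : ∀ i, 1 ≤ d i) {t : ℝ} {z : CProj n}
    (T : Tracks f g γ t z) : 0 < supNorm (seg f g t) :=
  (T.stepData hn hd (t' := t) (by
    rw [ShortStep, sub_self, zero_mul, mul_zero]
    exact mul_nonneg (by norm_num) (supNorm_nonneg _)) ⟨le_rfl, le_rfl⟩).supNorm_pos

theorem nextTime_spec (hn : 1 ≤ n) (hd : ∀ i, 1 ≤ d i) {t : ℝ} (ht : 0 ≤ t) (ht1 : t ≤ 1)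
    {z : CProj n} (T : Tracks f g γ t z) :
    t ≤ nextTime f g t z ∧ nextTime f g t z ≤ 1 ∧ ShortStep f g t (nextTime f g t z) z ∧
      (nextTime f g t z ≠ 1 →
        maxDeg d * condReal (seg f g t) (unitRep z) ^ 2 *
          ((nextTime f g t z - t) * supNorm (f - g)) = 0.03 * supNorm (seg f g t)) := by
  have hS := T.supNorm_pos hn hd
  have hM := one_le_condReal hn hd (norm_unitRep z) T.nonsingular
  have hD : (1 : ℝ) ≤ maxDeg d := by exact_mod_cast one_le_maxDeg hn hd
  have hlen : stepLength f g t z = ENNReal.ofReal (0.03 * supNorm (seg f g t)) /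
      ENNReal.ofReal (supNorm (f - g) * maxDeg d * condReal (seg f g t) (unitRep z) ^ 2) := by
    have h0 := supNorm_nonneg (f - g)
    rw [stepLength, cond_eq T.nonsingular, ENNReal.ofReal_mul (p := supNorm (f - g) * _)
      (by positivity), ENNReal.ofReal_mul h0, ENNReal.ofReal_pow (by positivity),
      ENNReal.ofReal_natCast]
  unfold nextTime ShortStep
  rw [hlen]
  set S := supNorm (seg f g t)
  set M := condReal (seg f g t) (unitRep z)
  rcases (supNorm_nonneg (f - g)).eq_or_lt with h0 | h0
  -- If ‖f - g‖_∞ = 0, division by zero in [0, ∞] makes the step infinite and the loop ends at once.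
  · have hpos : ENNReal.ofReal (0.03 * S) ≠ 0 := by
      rw [Ne, ENNReal.ofReal_eq_zero, not_le]; positivity
    rw [← h0, zero_mul, zero_mul, ENNReal.ofReal_zero, ENNReal.div_zero hpos, add_top,
      min_eq_right le_top, ENNReal.toReal_one]
    refine ⟨ht1, le_rfl, ?_, fun h => absurd rfl h⟩
    rw [mul_zero, mul_zero]
    positivity
  · have hden : 0 < supNorm (f - g) * maxDeg d * M ^ 2 := by positivity
    have hΔ : 0 ≤ 0.03 * S / (supNorm (f - g) * maxDeg d * M ^ 2) := by positivity
    have hmul : maxDeg d * M ^ 2 *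
        (0.03 * S / (supNorm (f - g) * maxDeg d * M ^ 2) * supNorm (f - g)) = 0.03 * S := by
      field_simp
    rw [← ENNReal.ofReal_div_of_pos hden, ← ENNReal.ofReal_add ht hΔ, ← ENNReal.ofReal_one,
      ← ENNReal.ofReal_min, ENNReal.toReal_ofReal (le_min (by positivity) zero_le_one)]
    set Δ := 0.03 * S / (supNorm (f - g) * maxDeg d * M ^ 2)
    refine ⟨le_min (by linarith) ht1, min_le_right _ _, ?_, fun hne => ?_⟩
    · rw [← hmul]
      gcongr
      linarith [min_le_left (t + Δ) 1]
    · rcases min_choice (t + Δ) 1 with h | h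
      · rw [h, add_sub_cancel_left, hmul]
      · exact absurd h hne

theorem one_le_step_integral (hn : 1 ≤ n) (hd : ∀ i, 1 ≤ d i) (hγ : IsLifting f g ζ γ)
    (hns : ∀ t ∈ Set.Icc (0 : ℝ) 1, IsNonsingularAt (seg f g t) (γ t)) {t t' : ℝ}
    (ht : 0 ≤ t) (htt' : t ≤ t') (ht' : t' ≤ 1) {z : CProj n} (T : Tracks f g γ t z)
    (hs : maxDeg d * condReal (seg f g t) (unitRep z) ^ 2 * ((t' - t) * supNorm (f - g)) =
      0.03 * supNorm (seg f g t)) :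
    1 ≤ 45 * (maxDeg d : ℝ≥0∞) * ENNReal.ofReal (supNorm (f - g)) *
      ∫⁻ τ in Set.Ioc t t', integrand f g γ τ := by
  have hS := T.supNorm_pos hn hd
  set S := supNorm (seg f g t)
  set M := condReal (seg f g t) (unitRep z)
  have h0 := supNorm_nonneg (f - g)
  have h1 : ENNReal.ofReal (M ^ 2 / S / 1.25) * ENNReal.ofReal (t' - t) ≤
      ∫⁻ τ in Set.Ioc t t', integrand f g γ τ := by
    calc ENNReal.ofReal (M ^ 2 / S / 1.25) * ENNReal.ofReal (t' - t)
        = ∫⁻ _ in Set.Ioc t t', ENNReal.ofReal (M ^ 2 / S / 1.25) := by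
          rw [MeasureTheory.setLIntegral_const, Real.volume_Ioc]
      _ ≤ _ := MeasureTheory.setLIntegral_mono' measurableSet_Ioc fun τ hτ =>
          T.le_integrand hn hd hγ hns ht ht' hs.le ⟨hτ.1.le, hτ.2⟩
  have htt : 0 ≤ t' - t := by linarith
  calc (1 : ℝ≥0∞) ≤ ENNReal.ofReal
        (45 * maxDeg d * supNorm (f - g) * (M ^ 2 / S / 1.25 * (t' - t))) := by
        rw [ENNReal.one_le_ofReal]
        have : 45 * maxDeg d * supNorm (f - g) * (M ^ 2 / S / 1.25 * (t' - t)) =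
            45 / 1.25 / S * (maxDeg d * M ^ 2 * ((t' - t) * supNorm (f - g))) := by
          field_simp
        rw [this, hs]
        have : 45 / 1.25 / S * (0.03 * S) = 1.08 := by field_simp; norm_num
        rw [this]
        norm_num
    _ = 45 * (maxDeg d : ℝ≥0∞) * ENNReal.ofReal (supNorm (f - g)) *
        (ENNReal.ofReal (M ^ 2 / S / 1.25) * ENNReal.ofReal (t' - t)) := by
        rw [ENNReal.ofReal_mul (by positivity), ENNReal.ofReal_mul (by positivity),
          ENNReal.ofReal_mul (by norm_num), ENNReal.ofReal_mul (by positivity),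
          ENNReal.ofReal_natCast, ENNReal.ofReal_ofNat]
    _ ≤ _ := by gcongr

/-- Induction on an integer bound N for the remaining cost: a step that is not final uses up at
least 1 of it. With N = 0 only a final step is possible, and this step is the summand 1. -/
theorem exists_loopRun (hn : 1 ≤ n) (hd : ∀ i, 1 ≤ d i) (hγ : IsLifting f g ζ γ)
    (hns : ∀ t ∈ Set.Icc (0 : ℝ) 1, IsNonsingularAt (seg f g t) (γ t)) (N : ℕ) :
    ∀ (t : ℝ) (z : CProj n), 0 ≤ t → t ≤ 1 → Tracks f g γ t z →
      45 * (maxDeg d : ℝ≥0∞) * ENNReal.ofReal (supNorm (f - g)) *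
        ∫⁻ τ in Set.Ioc t 1, integrand f g γ τ ≤ N →
      ∃ (K : ℕ) (w : CProj n), LoopRun f g t z K w ∧
        (K : ℝ≥0∞) ≤ 1 + 45 * (maxDeg d : ℝ≥0∞) * ENNReal.ofReal (supNorm (f - g)) *
          ∫⁻ τ in Set.Ioc t 1, integrand f g γ τ ∧ Tracks f g γ 1 w := by
  induction N with
  | zero =>
    intro t z ht ht1 T hN
    obtain ⟨h1, h2, h3, h4⟩ := nextTime_spec hn hd ht ht1 T
    obtain ⟨z', hz', T'⟩ := T.exists_newton hn hd hγ ht h1 h2 h3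
    have hone : nextTime f g t z = 1 := by
      by_contra hne
      have h5 := one_le_step_integral hn hd hγ hns ht h1 h2 T (h4 hne)
      have h6 : ∫⁻ τ in Set.Ioc t (nextTime f g t z), integrand f g γ τ ≤
          ∫⁻ τ in Set.Ioc t 1, integrand f g γ τ :=
        MeasureTheory.lintegral_mono_set (Set.Ioc_subset_Ioc_right h2)
      have h7 := (h5.trans (mul_le_mul_right h6 _)).trans hN
      simp at h7
    exact ⟨1, z', .halt hone hz', by simp, hone ▸ T'⟩
  | succ N ih =>
    intro t z ht ht1 T hN
    obtain ⟨h1, h2, h3, h4⟩ := nextTime_spec hn hd ht ht1 T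
    obtain ⟨z', hz', T'⟩ := T.exists_newton hn hd hγ ht h1 h2 h3
    rcases eq_or_ne (nextTime f g t z) 1 with hone | hne
    · exact ⟨1, z', .halt hone hz', by simp, hone ▸ T'⟩
    have h5 := one_le_step_integral hn hd hγ hns ht h1 h2 T (h4 hne)
    have hsplit : ∫⁻ τ in Set.Ioc t 1, integrand f g γ τ =
        (∫⁻ τ in Set.Ioc t (nextTime f g t z), integrand f g γ τ) +
          ∫⁻ τ in Set.Ioc (nextTime f g t z) 1, integrand f g γ τ := by
      -- Additivity over measurable sets needs no measurability of the integrand.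
      rw [← Set.Ioc_union_Ioc_eq_Ioc h1 h2]
      exact MeasureTheory.lintegral_union measurableSet_Ioc (Set.Ioc_disjoint_Ioc_of_le le_rfl)
    rw [hsplit, mul_add] at hN ⊢
    set C := 45 * (maxDeg d : ℝ≥0∞) * ENNReal.ofReal (supNorm (f - g))
    have hN' : C * ∫⁻ τ in Set.Ioc (nextTime f g t z) 1, integrand f g γ τ ≤ N := by
      have h6 : 1 + C * ∫⁻ τ in Set.Ioc (nextTime f g t z) 1, integrand f g γ τ ≤ 1 + N := by
        refine (add_le_add_left h5 _).trans (hN.trans (le_of_eq ?_))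
        push_cast
        ring
      exact (ENNReal.add_le_add_iff_left ENNReal.one_ne_top).mp h6
    obtain ⟨K, w, hrun, hK, Tw⟩ := ih _ z' (ht.trans h1) h2 T' hN'
    refine ⟨K + 1, w, .next hne hz' hrun, ?_, Tw⟩
    push_cast
    rw [add_comm]
    gcongr
    exact hK.trans (add_le_add_left h5 _)

/-- The one-step perturbation bounds, centred at the exact zero γ t, control the condition at γ s
for all s near t on either side. -/
theorem integrand_locally_bounded (hn : 1 ≤ n) (hd : ∀ i, 1 ≤ d i) (hγ : IsLifting f g ζ γ)
    (hns : ∀ t ∈ Set.Icc (0 : ℝ) 1, IsNonsingularAt (seg f g t) (γ t)) {t : ℝ}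
    (ht : t ∈ Set.Icc (0 : ℝ) 1) :
    ∃ C : ℝ, ∀ᶠ s in nhdsWithin t (Set.Icc 0 1), integrand f g γ s ≤ ENNReal.ofReal C := by
  set y := unitRep (γ t)
  have hinv : (tangentDeriv (seg f g t) y).IsInvertible := hns t ht
  have hM := one_le_condReal hn hd (norm_unitRep (γ t)) (hns t ht)
  have hD : (1 : ℝ) ≤ maxDeg d := by exact_mod_cast one_le_maxDeg hn hd
  have hS : 0 < supNorm (seg f g t) := by
    refine (supNorm_nonneg _).lt_of_ne fun h0 => ?_
    rw [condReal, ← h0] at hM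
    norm_num at hM
  set B := maxDeg d * condReal (seg f g t) y with hB
  have hB1 : 1 ≤ B := one_le_mul_of_one_le_of_one_le hD hM
  refine ⟨n * (1.03 * supNorm (seg f g t)) * (1.102 * invNorm (seg f g t) y) ^ 2, ?_⟩
  have e1 : ∀ᶠ s in nhdsWithin t (Set.Icc 0 1), distP (γ s) (γ t) < 0.03 / B :=
    (hγ.cont t ht).eventually_lt_const (by positivity)
  have e2 : ∀ᶠ s in nhdsWithin t (Set.Icc 0 1),
      maxDeg d * condReal (seg f g t) y ^ 2 * (|s - t| * supNorm (f - g)) <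
        0.03 * supNorm (seg f g t) := by
    have hc : ContinuousWithinAt (fun s : ℝ => maxDeg d * condReal (seg f g t) y ^ 2 *
        (|s - t| * supNorm (f - g))) (Set.Icc 0 1) t := by fun_prop
    refine hc.tendsto.eventually_lt_const ?_
    rw [sub_self, abs_zero, zero_mul, mul_zero]
    positivity
  filter_upwards [e1, e2, self_mem_nhdsWithin] with s h1 h2 hs
  have St : StepData (seg f g t) (seg f g s) y := by
    refine ⟨hn, hd, norm_unitRep _, hinv, le_trans ?_ h2.le⟩
    gcongr
    exact supNorm_seg_sub_le f g s t
  have h3 : 1 - ‖(inner ℂ y (unitRep (γ s)) : ℂ)‖ ^ 2 ≤ (0.03 / B) ^ 2 := by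
    rw [norm_inner_symm]
    refine (one_sub_sq_le_arccos_sq _).trans ?_
    have : 0 ≤ distP (γ s) (γ t) := Real.arccos_nonneg _
    exact pow_le_pow_left₀ this h1.le 2
  obtain ⟨hne, hch⟩ := norm_chartVec_le (norm_unitRep (γ t)) (norm_unitRep (γ s)) (by positivity)
    (div_le_self (by norm_num) hB1) h3
  have hX : B * ‖chartVec y (unitRep (γ s))‖ ≤ 0.037 := by
    calc B * ‖chartVec y (unitRep (γ s))‖ ≤ B * (1.001 * (0.03 / B)) := by gcongr
      _ = 1.001 * 0.03 := by field_simp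
      _ ≤ 0.037 := by norm_num
  have hν := invNorm_nonneg (seg f g t) y
  have h4 := (St.invBound_zero (zeroChart_unitRep (hγ.zero s hs) hne) hX).invNorm_le hd
    (unitRep_ne_zero _) (by positivity)
  have h5 := invNorm_nonneg (seg f g s) (unitRep (γ s))
  have h6 := St.supNorm_right_le
  rw [integrand_eq hn hd (hns s hs)]
  refine ENNReal.ofReal_le_ofReal ?_
  exact mul_le_mul (mul_le_mul_of_nonneg_left h6 (Nat.cast_nonneg n)) (pow_le_pow_left₀ h5 h4 2)
    (sq_nonneg _) (mul_nonneg (Nat.cast_nonneg n) (mul_nonneg (by norm_num) hS.le))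

theorem condIntegral_ne_top (hn : 1 ≤ n) (hd : ∀ i, 1 ≤ d i) (hγ : IsLifting f g ζ γ)
    (hns : ∀ t ∈ Set.Icc (0 : ℝ) 1, IsNonsingularAt (seg f g t) (γ t)) :
    condIntegral f g γ ≠ ⊤ := by
  have hb : ∃ C : ℝ, ∀ t ∈ Set.Icc (0 : ℝ) 1, integrand f g γ t ≤ ENNReal.ofReal C := by
    refine isCompact_Icc.induction_on
      (p := fun s => ∃ C : ℝ, ∀ t ∈ s, integrand f g γ t ≤ ENNReal.ofReal C)
      ⟨0, by simp⟩ (fun s t hst ⟨C, hC⟩ => ⟨C, fun r hr => hC r (hst hr)⟩) ?_ ?_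
    · rintro s t ⟨C, hC⟩ ⟨C', hC'⟩
      refine ⟨max C C', fun r hr => ?_⟩
      rcases hr with hr | hr
      · exact (hC r hr).trans (ENNReal.ofReal_le_ofReal (le_max_left _ _))
      · exact (hC' r hr).trans (ENNReal.ofReal_le_ofReal (le_max_right _ _))
    · intro t ht
      obtain ⟨C, hC⟩ := integrand_locally_bounded hn hd hγ hns ht
      exact ⟨_, hC, C, fun _ h => h⟩
  obtain ⟨C, hC⟩ := hb
  have h : condIntegral f g γ ≤ ∫⁻ _ in Set.Icc (0 : ℝ) 1, ENNReal.ofReal C :=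
    MeasureTheory.setLIntegral_mono' measurableSet_Icc hC
  refine ne_top_of_le_ne_top ?_ h
  rw [MeasureTheory.setLIntegral_const, Real.volume_Icc]
  exact ENNReal.mul_ne_top ENNReal.ofReal_ne_top ENNReal.ofReal_ne_top

theorem IsLifting.tracks_zero (hγ : IsLifting f g ζ γ)
    (hns : IsNonsingularAt (seg f g 0) (γ 0)) : Tracks f g γ 0 ζ := by
  have h1 : (inner ℂ (unitRep ζ) (unitRep ζ) : ℂ) = 1 := by
    rw [inner_self_eq_norm_sq_to_K, norm_unitRep]
    simp
  have h2 : chartVec (unitRep ζ) (unitRep ζ) = 0 := by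
    rw [chartVec, h1, inv_one, one_smul, sub_self]
  rw [hγ.start] at hns
  refine ⟨hns, ?_, ?_⟩
  · rw [hγ.start, h1]
    exact one_ne_zero
  · rw [hγ.start, h2, norm_zero, mul_zero]
    norm_num

theorem Tracks.isApproxZero (hn : 1 ≤ n) (hd : ∀ i, 1 ≤ d i) (hγ : IsLifting f g ζ γ)
    (hns : IsNonsingularAt (seg f g 1) (γ 1)) {z : CProj n} (T : Tracks f g γ 1 z) :
    IsApproxZero f z (γ 1) := by
  have hz := hγ.zero 1 ⟨zero_le_one, le_rfl⟩
  have h := (zeroChart_unitRep hz T.inner_ne_zero).cond_right hn hd T.nonsingular T.close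
  rw [seg_one] at hz hns h
  exact isApproxZero_of_chartVec hn hd hz hns T.inner_ne_zero h

end Algorithm

end LinearHomotopy

end

open LinearHomotopy
theorem theorem5p2 (n : ℕ) (hn : 1 ≤ n) (d : Fin n → ℕ) (hd : ∀ i, 1 ≤ d i)
    (f g : HomSys n d) (ζ : CProj n) (γ : ℝ → CProj n)
    (hγ : IsLifting f g ζ γ)
    (hns : ∀ t ∈ Set.Icc (0 : ℝ) 1, IsNonsingularAt (seg f g t) (γ t)) :
    condIntegral f g γ ≠ ⊤ ∧
    ∃ (K : ℕ) (z : CProj n),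
      ALHInfty f g ζ K z ∧
      (K : ℝ≥0∞) ≤ 1 + 45 * (maxDeg d : ℝ≥0∞) * ENNReal.ofReal (supNorm (f - g)) *
        condIntegral f g γ ∧
      IsApproxZero f z (γ 1) := by
  have hfin := condIntegral_ne_top hn hd hγ hns
  refine ⟨hfin, ?_⟩
  have hI : ∫⁻ τ in Set.Ioc (0 : ℝ) 1, integrand f g γ τ ≤ condIntegral f g γ :=
    MeasureTheory.lintegral_mono_set Set.Ioc_subset_Icc_self
  have hC : 45 * (maxDeg d : ℝ≥0∞) * ENNReal.ofReal (supNorm (f - g)) *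
      condIntegral f g γ ≠ ⊤ := by finiteness
  obtain ⟨N, hN⟩ := ENNReal.exists_nat_gt hC
  obtain ⟨K, z, hrun, hK, T⟩ := exists_loopRun hn hd hγ hns N 0 ζ le_rfl zero_le_one
    (hγ.tracks_zero (hns 0 ⟨le_rfl, zero_le_one⟩)) (le_trans (by gcongr) hN.le)
  exact ⟨K, z, hrun, hK.trans (by gcongr),
    T.isApproxZero hn hd hγ (hns 1 ⟨zero_le_one, le_rfl⟩)⟩
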